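/- Let $R$ be a Noetherian Cohen–Macaulay domain, and let $M$ be a finitely generated $R$-module that admits a resolution of finite length by finitely generated free modules. Let $$\cdots \to F^{-i-1} \xrightarrow{\partial^{-i-1}} F^{-i} \xrightarrow{\partial^{-i}} F^{-i+1}\to\cdots\to F^{-1}\xrightarrow{\partial^{-1}} F^0\to 0$$ be any resolution of $M$ by finitely generated free $R$-modules (put $F^j=0$ for $j>0$). For a map $\varphi$ of finitely generated free modules let $I_k(\varphi)$ be the ideal generated by the $k\times k$ minors of a matrix of $\varphi$. For $i\ge 0$ put $$I^{-i}(M)=I_{\operatorname{rank}\partial^{-i}}(\partial^{-i}),\qquad J^{-i}(M)=I_{\operatorname{rank}F^{-i}}(\partial^{-i-1}\oplus\partial^{-i}),$$ and let $\mathcal V^{-i}(M)=\operatorname{Spec}(R/\operatorname{rad}J^{-i}(M))$, where $\operatorname{Spec}$ is the maximal spectrum, viewed as a subset of $\operatorname{Spec}R$, i.e. the set of maximal ideals of $R$ containing $\operatorname{rad}J^{-i}(M)$. Its codimension is the height of the ideal $\operatorname{rad}J^{-i}(M)$ (which is $\infty$ if $J^{-i}(M)=R$), and its irreducible components are understood as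 the minimal primes of $\operatorname{rad}J^{-i}(M)$. Then $J^0(M)\subseteq I^{-1}(M)$, $\operatorname{rad}J^0(M)=\operatorname{rad}\operatorname{Ann}(M)$, and $\operatorname{rad}I^{-i}(M)=\operatorname{rad}J^{-i}(M)$ for all $i\ge1$. Moreover: (i) (Propagation) For all $i\ge 0$, $\operatorname{rad}J^{-i}(M)\subseteq\operatorname{rad}J^{-i-1}(M)$, and hence $\mathcal V^{-i}(M)\supseteq\mathcal V^{-i-1}(M)$. (ii) (Codimension lower bound) $\operatorname{codim}\mathcal V^{-i}(M)\ge i$ for all $i\ge0$. (iii) If $\mathfrak p$ is a minimal prime of $\operatorname{rad}J^0(M)$ of height $d$, then every maximal ideal containing $\mathfrak p$ lies in $\mathcal V^{-d}(M)$, and $\mathfrak p$ is a minimal prime of $\operatorname{rad}J^{-d}(M)$; that is, an irreducible component of $\mathcal V^0(M)$ of codimension $d$ is contained in, and is an irreducible component of, $\mathcal V^{-d}(M)$. (iv) Suppose that $\mathcal V^0(M)$ has (finite) codimension $d\ge0$. Then $$\operatorname{rad}J^0(M)=\operatorname{rad}J^{-1}(M)=\cdots=\operatorname{rad}J^{-d}(M)\ne\operatorname{rad}J^{-d-1}(M),$$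 and in particular $\mathcal V^0(M)=\cdots=\mathcal V^{-d}(M)$. If $R$ is a Jacobson ring, then also $\mathcal V^{-d}(M)\neq\mathcal V^{-d-1}(M)$ as sets of maximal ideals. If moreover (for arbitrary $R$ as above) $\operatorname{codim}\mathcal V^{-k}(M)>k$ for all $k>d$, then $\mathcal V^0(M)$ is pure: all minimal primes of $\operatorname{rad}J^0(M)$ have height $d$. If in addition $\operatorname{ht}\mathfrak p+\dim R/\mathfrak p=\dim R$ for every prime $\mathfrak p$ of $R$, then all the rings $R/\mathfrak p$, with $\mathfrak p$ a minimal prime of $\operatorname{rad}J^0(M)$, have the same Krull dimension. (v) (Generic vanishing) There is a non-empty open subset $U$ of the prime spectrum of $R$ such that $H^i(F^\bullet\otimes_R\kappa(\mathfrak p))=0$ for all $i\ne0$ and all $\mathfrak p\in U$, where $\kappa(\mathfrak p)$ is the residue field of $\mathfrak p$, and in particular $H^i(F^\bullet\otimes_R R/\chi)=0$ for all $i\neq0$ and every maximal ideal $\chi\in U$. If $R$ is a Jacobson ring, there is a non-empty Zariski open subset $U$ of the maximal spectrum of $R$ such that $H^i(F^\bullet\otimes_RR/\chi)=0$ for all $i\ne0$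 and all $\chi\in U$. (vi) (Signed Euler characteristic) If $F^\bullet$ has finite length, then $\sum_{i\le0}(-1)^i\operatorname{rank}F^i\ge0$. -/

import Mathlib

noncomputable section

namespace JumpLoci

open TensorProduct

/-! ### Cohen–Macaulay rings -/

/-- A (Noetherian) ring is Cohen–Macaulay if each of its local rings `R_p` has depth equal to its
Krull dimension.  Since the length of a regular sequence in the maximal ideal of a Noetherian
local ring never exceeds the dimension, this says that some regular sequence contained in the
maximal ideal has length `dim R_p`. -/
def IsCohenMacaulay (R : Type*) [CommRing R] : Prop :=
  ∀ (p : Ideal R) [p.IsPrime], ∃ rs : List (Localization.AtPrime p),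
    (∀ r ∈ rs, r ∈ IsLocalRing.maximalIdeal (Localization.AtPrime p)) ∧
    RingTheory.Sequence.IsRegular (Localization.AtPrime p) rs ∧
    (rs.length : WithBot ℕ∞) = ringKrullDim (Localization.AtPrime p)

/-! ### Determinantal ideals -/

section Minors

variable {R : Type*} [CommRing R]

/-- The ideal generated by the `k × k` minors of a matrix.  The rows and columns are chosen by
arbitrary maps; the choices that are not injective contribute the determinant `0`. -/
def matrixMinorsIdeal {m n : Type*} (A : Matrix m n R) (k : ℕ) : Ideal R :=
  Ideal.span {x | ∃ (f : Fin k → m) (g : Fin k → n), x = (A.submatrix f g).det}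

/-- The determinantal ideal `I_k(φ)` of a map of finitely generated free modules: the ideal
generated by the `k × k` minors of a matrix of `φ`.  It does not depend on the bases, see
`determinantalIdeal_eq`. -/
def determinantalIdeal {M N : Type*} [AddCommGroup M] [Module R M] [Module.Free R M]
    [Module.Finite R M] [AddCommGroup N] [Module R N] [Module.Free R N] [Module.Finite R N]
    (φ : M →ₗ[R] N) (k : ℕ) : Ideal R :=
  open Classical in
  matrixMinorsIdeal
    (LinearMap.toMatrix (Module.Free.chooseBasis R M) (Module.Free.chooseBasis R N) φ) k

theorem matrixMinorsIdeal_mul_le_right {m n l : Type*} [Fintype m] [DecidableEq m]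
    (A : Matrix l m R) (B : Matrix m n R) (k : ℕ) :
    matrixMinorsIdeal (A * B) k ≤ matrixMinorsIdeal B k := by
  refine Ideal.span_le.2 ?_
  rintro _ ⟨f, g, rfl⟩
  have h : (A * B).submatrix f g
      = fun a => ∑ j : m, A (f a) j • (fun b => B j (g b)) := by
    ext a b
    simp [Matrix.mul_apply, Finset.sum_apply]
  have h2 : ((A * B).submatrix f g).det
      = ∑ s : Fin k → m, (∏ a, A (f a) (s a)) * (B.submatrix s g).det := by
    rw [h]
    change (Matrix.detRowAlternating (R := R) (n := Fin k)).toMultilinearMap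
      (fun a => ∑ j : m, A (f a) j • (fun b => B j (g b))) = _
    rw [MultilinearMap.map_sum]
    refine Finset.sum_congr rfl fun s _ => ?_
    rw [MultilinearMap.map_smul_univ]
    rfl
  rw [SetLike.mem_coe, h2]
  exact Ideal.sum_mem _ fun s _ => Ideal.mul_mem_left _ _ (Ideal.subset_span ⟨s, g, rfl⟩)

theorem matrixMinorsIdeal_transpose {m n : Type*} (A : Matrix m n R) (k : ℕ) :
    matrixMinorsIdeal A.transpose k = matrixMinorsIdeal A k := by
  unfold matrixMinorsIdeal
  congr 1
  ext x
  constructor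
  · rintro ⟨f, g, rfl⟩
    exact ⟨g, f, by rw [← Matrix.det_transpose]; rfl⟩
  · rintro ⟨f, g, rfl⟩
    exact ⟨g, f, by rw [← Matrix.det_transpose]; rfl⟩

theorem matrixMinorsIdeal_mul_le_left {m n l : Type*} [Fintype m] [DecidableEq m]
    (A : Matrix l m R) (B : Matrix m n R) (k : ℕ) :
    matrixMinorsIdeal (A * B) k ≤ matrixMinorsIdeal A k := by
  rw [← matrixMinorsIdeal_transpose (A * B), Matrix.transpose_mul,
    ← matrixMinorsIdeal_transpose A]
  exact matrixMinorsIdeal_mul_le_right _ _ _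

theorem matrixMinorsIdeal_toMatrix_le {M N : Type*} [AddCommGroup M] [Module R M]
    [AddCommGroup N] [Module R N] {ι κ ι' κ' : Type*} [Fintype ι] [Fintype κ] [Fintype ι']
    [Fintype κ'] [DecidableEq ι] [DecidableEq κ] [DecidableEq ι'] [DecidableEq κ']
    (b : Module.Basis ι R M) (c : Module.Basis κ R N) (b' : Module.Basis ι' R M)
    (c' : Module.Basis κ' R N) (φ : M →ₗ[R] N) (k : ℕ) :
    matrixMinorsIdeal (LinearMap.toMatrix b c φ) k
      ≤ matrixMinorsIdeal (LinearMap.toMatrix b' c' φ) k := by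
  have h : LinearMap.toMatrix b c φ = LinearMap.toMatrix c' c LinearMap.id *
      (LinearMap.toMatrix b' c' φ * LinearMap.toMatrix b b' LinearMap.id) := by
    rw [← LinearMap.toMatrix_comp b b' c', ← LinearMap.toMatrix_comp b c' c]
    simp
  rw [h]
  exact (matrixMinorsIdeal_mul_le_right _ _ _).trans (matrixMinorsIdeal_mul_le_left _ _ _)

/-- `I_k(φ)` can be computed in any bases. -/
theorem determinantalIdeal_eq {M N : Type*} [AddCommGroup M] [Module R M] [Module.Free R M]
    [Module.Finite R M] [AddCommGroup N] [Module R N] [Module.Free R N] [Module.Finite R N]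
    {ι κ : Type*} [Fintype ι] [Fintype κ] [DecidableEq ι] [DecidableEq κ]
    (b : Module.Basis ι R M) (c : Module.Basis κ R N) (φ : M →ₗ[R] N) (k : ℕ) :
    determinantalIdeal φ k = matrixMinorsIdeal (LinearMap.toMatrix b c φ) k := by
  classical
  unfold determinantalIdeal
  refine le_antisymm ?_ ?_
  · convert matrixMinorsIdeal_toMatrix_le (Module.Free.chooseBasis R M)
      (Module.Free.chooseBasis R N) b c φ k
  · convert matrixMinorsIdeal_toMatrix_le b c (Module.Free.chooseBasis R M)
      (Module.Free.chooseBasis R N) φ k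

end Minors

/-! ### Free resolutions

A complex `⋯ → F^{-2} → F^{-1} → F^0 → 0` is given by modules `F n`, standing for `F^{-n}`, and
maps `d n : F (n + 1) → F n`, standing for the differential `∂^{-n-1} : F^{-n-1} → F^{-n}`. -/

section Resolutions

variable {R : Type*} [CommRing R]

/-- `⋯ → F 2 → F 1 → F 0 → M → 0` is exact. -/
structure IsResolution {M : Type*} [AddCommGroup M] [Module R M] {F : ℕ → Type*}
    [∀ n, AddCommGroup (F n)] [∀ n, Module R (F n)] (d : ∀ n, F (n + 1) →ₗ[R] F n)
    (ε : F 0 →ₗ[R] M) : Prop where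
  surjective : Function.Surjective ε
  exact_zero : Function.Exact (d 0) ε
  exact_succ : ∀ n, Function.Exact (d (n + 1)) (d n)

/-- `M` has a resolution of finite length by finitely generated free modules. -/
def HasFiniteFreeResolution (R : Type*) [CommRing R] (M : Type*) [AddCommGroup M]
    [Module R M] : Prop :=
  ∃ (r : ℕ → ℕ) (d : ∀ n, (Fin (r (n + 1)) → R) →ₗ[R] (Fin (r n) → R))
    (ε : (Fin (r 0) → R) →ₗ[R] M),
    IsResolution (F := fun n => Fin (r n) → R) d ε ∧ ∃ N, ∀ n, N < n → r n = 0

variable {F : ℕ → Type*} [∀ n, AddCommGroup (F n)] [∀ n, Module R (F n)]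
  [∀ n, Module.Free R (F n)] [∀ n, Module.Finite R (F n)]

/-- The fitting ideal `I^{-n} = I_{rank ∂^{-n}}(∂^{-n})`.  The rank of a map of free modules over
a domain is the rank of its image. For `n = 0` the differential is the map `F^0 → 0`. -/
def fittingIdeal (d : ∀ n, F (n + 1) →ₗ[R] F n) : ℕ → Ideal R
  | 0 => determinantalIdeal (0 : F 0 →ₗ[R] PUnit.{1})
      (Module.finrank R (LinearMap.range (0 : F 0 →ₗ[R] PUnit.{1})))
  | n + 1 => determinantalIdeal (d n) (Module.finrank R (LinearMap.range (d n)))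

/-- The jumping ideal `J^{-n} = I_{rank F^{-n}}(∂^{-n-1} ⊕ ∂^{-n})`, where
`∂^{-n-1} ⊕ ∂^{-n} : F^{-n-1} ⊕ F^{-n} → F^{-n} ⊕ F^{-n+1}` is the block diagonal map and
`F^1 = 0`. -/
def jumpingIdeal (d : ∀ n, F (n + 1) →ₗ[R] F n) : ℕ → Ideal R
  | 0 => determinantalIdeal ((d 0).prodMap (0 : F 0 →ₗ[R] PUnit.{1})) (Module.finrank R (F 0))
  | n + 1 => determinantalIdeal ((d (n + 1)).prodMap (d n)) (Module.finrank R (F (n + 1)))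

/-- The jump locus `V^{-n}`: the maximal spectrum of `R / rad J^{-n}` as a subset of the maximal
spectrum of `R`. -/
def jumpLocus (d : ∀ n, F (n + 1) →ₗ[R] F n) (n : ℕ) : Set (MaximalSpectrum R) :=
  {χ | (jumpingIdeal d n).radical ≤ χ.asIdeal}

/-- The codimension of `V^{-n}`: the height of its ideal `rad J^{-n}`, that is the least height of
a minimal prime of that ideal, and `∞` if there is none. -/
def codimJumpLocus (d : ∀ n, F (n + 1) →ₗ[R] F n) (n : ℕ) : ℕ∞ :=
  (jumpingIdeal d n).radical.height

/-- The cohomology of `F ⊗ A` vanishes in all nonzero degrees. -/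
def CohomologyVanishes (d : ∀ n, F (n + 1) →ₗ[R] F n) (A : Type*) [AddCommGroup A]
    [Module R A] : Prop :=
  ∀ n, Function.Exact ((d (n + 1)).rTensor A) ((d n).rTensor A)

end Resolutions

end JumpLoci

end

set_option linter.unusedSectionVars false

namespace JumpLoci

open Matrix

/-! ### Contractions of matrix complexes -/

/-! Everything is reduced to one local condition: at a prime `p`, does some `δ ∉ p` act
null-homotopically on the term `F (n + 1)` of the resolution, i.e. is `δ • 1 = B * A₀ + A₁ * C`
(`IsContracted`)? Over a domain the ranks of consecutive differentials of an exact complex add up to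
the rank of the middle term, and ranks can only drop at the residue field of `p`. Hence `J^{-n-1} ⊄
p`, `I^{-n-1} ⊄ p` and the existence of such a `δ` are all equivalent: a maximal minor outside `p`
is itself a suitable `δ`. In degree zero the corresponding condition is that some `δ ∉ p`
annihilates `M`. Radicals are compared prime by prime, and propagation holds because a contraction
at one term gives a generalized inverse of the incoming differential, hence a contraction at the
next term.

The codimension bound is the inequality of projective dimension and depth in elementary form.
Comparison with a finite free resolution contracts any resolution in high degrees. Over a Noetherian
local ring of dimension at most `n` the contraction descends to the pair `A (n + 1)`, `A n`
(`IsAcyclic.isContracted_of_ringKrullDim_lt`): a nonzerodivisor of the maximal ideal lowers the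
dimension and shifts the complex by one, and in depth zero a socle element gives descent all the
way.

Cohen–Macaulayness enters in the opposite direction. If `p` is a minimal prime of `Ann M` of height
`c`, then `M_p` has a nonzero element killed by the maximal ideal, which contains a regular sequence
of length `c`. For `c > 0`, a contraction defining `J^{-c} ⊄ p` would force that element to vanish
(`IsAcyclic.exists_mulVec_eq_of_isWeaklyRegular`), so `J^{-c} ⊆ p`. Parts (iii) and (iv) follow from
this, propagation and the codimension bound. Generic vanishing is the codimension bound at the zero
ideal, and the Euler characteristic telescopes to the rank of the cokernel of `d 0`. -/

/-- The composition `A₀ * A₁ = 0` together with exactness, for matrices acting on column vectors. -/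
def MatrixExact {S : Type*} [CommRing S] {l m n : Type*} [Fintype m] [Fintype n]
    (A₁ : Matrix m n S) (A₀ : Matrix l m S) : Prop :=
  A₀ * A₁ = 0 ∧ ∀ v, A₀ *ᵥ v = 0 → ∃ w, A₁ *ᵥ w = v

/-- `δ` is null-homotopic at the middle term of the complex given by `A₁` and `A₀`. -/
def IsContracted {S : Type*} [CommRing S] {l m n : Type*} [Fintype l] [Fintype m] [Fintype n]
    [DecidableEq m] (δ : S) (A₁ : Matrix m n S) (A₀ : Matrix l m S) : Prop :=
  ∃ (B : Matrix m l S) (C : Matrix n m S), δ • (1 : Matrix m m S) = B * A₀ + A₁ * C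

section Contraction

variable {S : Type*} [CommRing S] {k l m n : Type*} [Fintype k] [Fintype l] [Fintype m] [Fintype n]
  [DecidableEq k] [DecidableEq l] [DecidableEq m] [DecidableEq n]

theorem MatrixExact.exists_mul_eq {A₁ : Matrix m n S} {A₀ : Matrix l m S} (h : MatrixExact A₁ A₀)
    {D : Matrix m k S} (hD : A₀ * D = 0) : ∃ C : Matrix n k S, A₁ * C = D := by
  have h1 : ∀ j, ∃ w, A₁ *ᵥ w = fun i => D i j := fun j => h.2 _ (by
    ext i
    exact congrFun (congrFun hD i) j)
  choose w hw using h1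
  refine ⟨Matrix.of fun i j => w j i, ?_⟩
  ext i j
  exact congrFun (hw j) i

/-- The columns of `δ • 1 - B * A₀` lie in the kernel of `A₀`, so exactness lifts them through `A₁`.
Thus a contraction amounts to a generalized inverse of `A₀` up to the factor `δ`. -/
theorem MatrixExact.isContracted {A₁ : Matrix m n S} {A₀ : Matrix l m S} (h : MatrixExact A₁ A₀)
    {δ : S} {B : Matrix m l S} (hB : δ • A₀ = A₀ * B * A₀) : IsContracted δ A₁ A₀ := by
  obtain ⟨C, hC⟩ := h.exists_mul_eq (D := δ • (1 : Matrix m m S) - B * A₀) (by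
    rw [Matrix.mul_sub, Matrix.mul_smul, Matrix.mul_one, hB, Matrix.mul_assoc, sub_self])
  exact ⟨B, C, by rw [hC]; abel⟩

theorem IsContracted.smul_left {δ : S} {A₁ : Matrix m n S} {A₀ : Matrix l m S}
    (h : IsContracted δ A₁ A₀) (h0 : A₀ * A₁ = 0) : ∃ B : Matrix m l S, δ • A₀ = A₀ * B * A₀ := by
  obtain ⟨B, C, h⟩ := h
  refine ⟨B, ?_⟩
  have := congrArg (A₀ * ·) h
  simpa [Matrix.mul_add, ← Matrix.mul_assoc, h0] using this

theorem IsContracted.smul_right {δ : S} {A₁ : Matrix m n S} {A₀ : Matrix l m S}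
    (h : IsContracted δ A₁ A₀) (h0 : A₀ * A₁ = 0) : ∃ B : Matrix n m S, δ • A₁ = A₁ * B * A₁ := by
  obtain ⟨B, C, h⟩ := h
  refine ⟨C, ?_⟩
  have := congrArg (· * A₁) h
  simpa [Matrix.add_mul, Matrix.mul_assoc, h0] using this

/-- A contraction also gives a generalized inverse of the incoming map `A₁`, so it moves one step to
the left with the same `δ`. This is the source of propagation. -/
theorem IsContracted.succ {δ : S} {A₂ : Matrix n k S} {A₁ : Matrix m n S} {A₀ : Matrix l m S}
    (h : IsContracted δ A₁ A₀) (h0 : A₀ * A₁ = 0) (h1 : MatrixExact A₂ A₁) :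
    IsContracted δ A₂ A₁ :=
  let ⟨_, hB⟩ := h.smul_right h0
  h1.isContracted hB

theorem IsContracted.map {T : Type*} [CommRing T] (f : S →+* T) {δ : S} {A₁ : Matrix m n S}
    {A₀ : Matrix l m S} (h : IsContracted δ A₁ A₀) :
    IsContracted (f δ) (A₁.map f) (A₀.map f) := by
  obtain ⟨B, C, h⟩ := h
  refine ⟨B.map f, C.map f, ?_⟩
  have := congrArg (fun M => M.map f) h
  simp only [Matrix.map_add f (map_add f), Matrix.map_mul] at this
  rw [← this]
  ext i j
  simp [Matrix.one_apply, apply_ite f]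

theorem IsContracted.one_of_isUnit {δ : S} (hδ : IsUnit δ) {A₁ : Matrix m n S}
    {A₀ : Matrix l m S} (h : IsContracted δ A₁ A₀) : IsContracted 1 A₁ A₀ := by
  obtain ⟨B, C, h⟩ := h
  obtain ⟨ε, hε⟩ := hδ.exists_left_inv
  refine ⟨ε • B, ε • C, ?_⟩
  rw [Matrix.smul_mul, Matrix.mul_smul, ← smul_add, ← h, smul_smul, hε]

theorem IsContracted.matrixExact {A₁ : Matrix m n S} {A₀ : Matrix l m S}
    (h : IsContracted 1 A₁ A₀) (h0 : A₀ * A₁ = 0) : MatrixExact A₁ A₀ := by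
  obtain ⟨B, C, h⟩ := h
  refine ⟨h0, fun v hv => ⟨C *ᵥ v, ?_⟩⟩
  have := congrArg (· *ᵥ v) h
  simpa [Matrix.add_mulVec, ← Matrix.mulVec_mulVec, hv] using this.symm

/-- Over a field, a section of `A₀` onto its image, extended along a retraction onto that image, is
a generalized inverse. -/
theorem MatrixExact.isContracted_of_field {K : Type*} [Field K] {A₁ : Matrix m n K}
    {A₀ : Matrix l m K} (h : MatrixExact A₁ A₀) : IsContracted 1 A₁ A₀ := by
  obtain ⟨g, hg⟩ := (Matrix.toLin' A₀).rangeRestrict.exists_rightInverse_of_surjective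
    (LinearMap.range_rangeRestrict _)
  obtain ⟨q, hq⟩ := (LinearMap.range (Matrix.toLin' A₀)).subtype.exists_leftInverse_of_injective
    (Submodule.ker_subtype _)
  refine h.isContracted (B := LinearMap.toMatrix' (g ∘ₗ q)) ?_
  rw [one_smul]
  apply Matrix.toLin'.injective
  rw [Matrix.toLin'_mul, Matrix.toLin'_mul, Matrix.toLin'_toMatrix']
  ext1 i
  ext1
  have h2 : ∀ x, q (Matrix.toLin' A₀ x) = ⟨Matrix.toLin' A₀ x, ⟨x, rfl⟩⟩ := fun x =>
    LinearMap.congr_fun hq ⟨Matrix.toLin' A₀ x, ⟨x, rfl⟩⟩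
  have h3 : ∀ y : LinearMap.range (Matrix.toLin' A₀), Matrix.toLin' A₀ (g y) = y := fun y =>
    congrArg Subtype.val (LinearMap.congr_fun hg y)
  simp only [LinearMap.comp_apply]
  rw [h2, h3]

theorem mul_aeval_eq_aeval_mul {U : Matrix m m S} {V : Matrix l l S} {A : Matrix l m S}
    (h : A * U = V * A) (q : Polynomial S) :
    A * Polynomial.aeval U q = Polynomial.aeval V q * A := by
  induction q using Polynomial.induction_on' with
  | add p q hp hq => simp [Matrix.mul_add, Matrix.add_mul, hp, hq]
  | monomial i a =>
    have : A * U ^ i = V ^ i * A := by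
      induction i with
      | zero => simp
      | succ i ih => rw [pow_succ, ← Matrix.mul_assoc, ih, Matrix.mul_assoc, h, pow_succ,
          Matrix.mul_assoc]
    rw [Polynomial.aeval_monomial, Polynomial.aeval_monomial, Algebra.algebraMap_eq_smul_one,
      Algebra.algebraMap_eq_smul_one, Matrix.smul_mul, Matrix.smul_mul, Matrix.one_mul,
      Matrix.one_mul, Matrix.mul_smul, Matrix.smul_mul, this]

/-- Over a local ring, a complex that is exact and remains exact over the residue field splits. -/
theorem MatrixExact.isContracted_of_local [IsLocalRing S] {A₁ : Matrix m n S}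
    {A₀ : Matrix l m S} (h : MatrixExact A₁ A₀)
    (h' : MatrixExact (A₁.map (IsLocalRing.residue S)) (A₀.map (IsLocalRing.residue S))) :
    IsContracted 1 A₁ A₀ := by
  -- Lift the splitting over the residue field entrywise. The resulting `U` reduces to the identity,
  -- so it is invertible, and `A₀ * U = (A₀ * B) * A₀`.
  obtain ⟨B', C', hBC⟩ := h'.isContracted_of_field
  have hsurj : Function.Surjective (IsLocalRing.residue S) := IsLocalRing.residue_surjective
  choose σ hσ using hsurj
  set B := B'.map σ
  set C := C'.map σ
  set U := B * A₀ + A₁ * C with hU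
  have hdet : IsUnit U.det := by
    rw [← IsLocalRing.residue_ne_zero_iff_isUnit, RingHom.map_det]
    have : (IsLocalRing.residue S).mapMatrix U = 1 := by
      simp only [RingHom.mapMatrix_apply, hU, Matrix.map_add _ (map_add _), Matrix.map_mul]
      have e1 : B.map (IsLocalRing.residue S) = B' := by ext; simp [B, hσ]
      have e2 : C.map (IsLocalRing.residue S) = C' := by ext; simp [C, hσ]
      rw [e1, e2, ← hBC, one_smul]
    rw [this]
    simp
  have hAU : A₀ * U = (A₀ * B) * A₀ := by
    rw [hU, Matrix.mul_add, ← Matrix.mul_assoc A₀ A₁, h.1, Matrix.zero_mul, add_zero,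
      Matrix.mul_assoc]
  have hc : IsUnit (U.charpoly.coeff 0) := by
    rw [Matrix.det_eq_sign_charpoly_coeff] at hdet
    exact isUnit_of_mul_isUnit_right hdet
  -- By Cayley–Hamilton the inverse of `U` is, up to a unit, the polynomial `-q` in `U`. Since `A₀`
  -- intertwines `U` with `A₀ * B`, this polynomial can be moved to the left of `A₀`, which exhibits
  -- the generalized inverse.
  set q := U.charpoly.divX
  have hCH : Polynomial.aeval U q * U + U.charpoly.coeff 0 • (1 : Matrix m m S) = 0 := by
    have := Matrix.aeval_self_charpoly U
    rw [← Polynomial.divX_mul_X_add U.charpoly] at this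
    simpa [Algebra.algebraMap_eq_smul_one] using this
  have hc2 : U.charpoly.coeff 0 • A₀
      = A₀ * (-(B * Polynomial.aeval (A₀ * B) q)) * A₀ := by
    have h1 := congrArg (A₀ * ·) hCH
    have hcomm : Polynomial.aeval U q * U = U * Polynomial.aeval U q :=
      (mul_aeval_eq_aeval_mul rfl q).symm
    simp only [Matrix.mul_add, Matrix.mul_zero, Matrix.mul_smul, Matrix.mul_one] at h1
    rw [hcomm, ← Matrix.mul_assoc, hAU, Matrix.mul_assoc _ A₀, mul_aeval_eq_aeval_mul hAU] at h1
    rw [eq_neg_of_add_eq_zero_right h1]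
    simp [Matrix.mul_assoc]
  exact (h.isContracted hc2).one_of_isUnit hc

end Contraction

/-! ### Acyclic complexes of matrices -/

section Acyclic

universe u

variable {S : Type u} [CommRing S] {r : ℕ → ℕ}

/-- The complex with differentials `A n` is exact in positive degrees. -/
def IsAcyclic (A : ∀ n, Matrix (Fin (r n)) (Fin (r (n + 1))) S) : Prop :=
  ∀ n, MatrixExact (A (n + 1)) (A n)

theorem exists_smul_add_of_map_mk_eq {m n : Type*} [Fintype n] {x : S} {A : Matrix m n S}
    {z : n → S} {w : m → S} (h : A.map (Ideal.Quotient.mk (Ideal.span {x})) *ᵥ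
      (Ideal.Quotient.mk (Ideal.span {x}) ∘ z) = Ideal.Quotient.mk (Ideal.span {x}) ∘ w) :
    ∃ v, A *ᵥ z = w + x • v := by
  have h1 : ∀ i, ∃ c, (A *ᵥ z) i - w i = x * c := fun i => by
    have h2 := congrFun h i
    rw [← RingHom.map_mulVec] at h2
    exact Ideal.mem_span_singleton'.1 (Ideal.Quotient.eq.1 h2) |>.imp fun c hc => by
      rw [← hc, mul_comm]
  choose v hv using h1
  refine ⟨v, funext fun i => ?_⟩
  rw [Pi.add_apply, Pi.smul_apply, smul_eq_mul, ← hv]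
  ring

theorem exists_mk_comp_eq {m : Type*} {I : Ideal S} (z : m → S ⧸ I) :
    ∃ y : m → S, Ideal.Quotient.mk I ∘ y = z := by
  choose y hy using fun i => Ideal.Quotient.mk_surjective (z i)
  exact ⟨y, funext hy⟩

theorem eq_zero_of_smul_eq_zero {m : Type*} {x : S} (hx : x ∈ nonZeroDivisors S) {w : m → S}
    (h : x • w = 0) : w = 0 :=
  funext fun i => (mem_nonZeroDivisors_iff.1 hx).1 _ (congrFun h i)

theorem map_mulVec_comp {T m n : Type*} [CommRing T] [Fintype n] (f : S →+* T) (A : Matrix m n S)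
    (v : n → S) : A.map f *ᵥ (f ∘ v) = f ∘ (A *ᵥ v) :=
  funext fun i => (RingHom.map_mulVec f A v i).symm

/-- Dividing by a nonzerodivisor keeps exactness in degrees at least two. -/
theorem IsAcyclic.map_mk {A : ∀ n, Matrix (Fin (r n)) (Fin (r (n + 1))) S} (hA : IsAcyclic A)
    {x : S} (hx : x ∈ nonZeroDivisors S) :
    IsAcyclic (r := fun n => r (n + 1))
      fun n => (A (n + 1)).map (Ideal.Quotient.mk (Ideal.span {x})) := by
  intro n
  refine ⟨?_, fun v hv => ?_⟩
  · rw [← Matrix.map_mul, (hA (n + 1)).1]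
    simp
  -- A lift `z` of a cycle has boundary `x • w`. As `x` is regular, `w` is a cycle one degree lower,
  -- hence a boundary of some `y`, and `z - x • y` is an honest cycle lifting `v`. The use of
  -- exactness at `w` is what costs one degree.
  · obtain ⟨z, rfl⟩ := exists_mk_comp_eq v
    obtain ⟨w, hw⟩ := exists_smul_add_of_map_mk_eq (w := 0) (hv.trans (by ext; simp))
    rw [zero_add] at hw
    have h0 : x • (A n *ᵥ w) = 0 := by
      rw [← Matrix.mulVec_smul, ← hw, Matrix.mulVec_mulVec, (hA n).1, Matrix.zero_mulVec]
    obtain ⟨y, rfl⟩ := (hA n).2 w (eq_zero_of_smul_eq_zero hx h0)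
    obtain ⟨t, ht⟩ := (hA (n + 1)).2 (z - x • y) (by
      rw [Matrix.mulVec_sub, hw, Matrix.mulVec_smul, sub_self])
    refine ⟨Ideal.Quotient.mk _ ∘ t, ?_⟩
    rw [map_mulVec_comp, ht]
    ext i
    simp

/-- If some nonzero element kills the maximal ideal, an acyclic complex that is eventually
contracted is contracted in all positive degrees. -/
theorem IsAcyclic.isContracted_of_mul_maximalIdeal_eq_zero [IsLocalRing S]
    {A : ∀ n, Matrix (Fin (r n)) (Fin (r (n + 1))) S} (hA : IsAcyclic A) {s : S} (hs0 : s ≠ 0)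
    (hs : ∀ a ∈ IsLocalRing.maximalIdeal S, s • a = 0)
    (hN : ∃ N, ∀ i, N ≤ i → IsContracted 1 (A (i + 1)) (A i)) (n : ℕ) :
    IsContracted 1 (A (n + 1)) (A n) := by
  obtain ⟨N, hN⟩ := hN
  have hdesc : ∀ i, IsContracted 1 (A (i + 2)) (A (i + 1)) →
      IsContracted 1 (A (i + 1)) (A i) := by
    intro i hi
    obtain ⟨B, hB⟩ := hi.smul_left (hA _).1
    rw [one_smul] at hB
    refine (hA i).isContracted_of_local ⟨?_, fun v hv => ?_⟩
    · rw [← Matrix.map_mul, (hA i).1]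
      simp
    · choose z hz using fun j => IsLocalRing.residue_surjective (v j)
      obtain rfl : IsLocalRing.residue S ∘ z = v := funext hz
      -- The entries of `A i *ᵥ z` lie in the maximal ideal, which `s` kills.
      have h0 : A i *ᵥ (s • z) = 0 := by
        ext j
        rw [Matrix.mulVec_smul, Pi.smul_apply, smul_eq_mul, mul_comm]
        have := congrFun hv j
        rw [← RingHom.map_mulVec] at this
        exact mul_comm s _ ▸ hs _ (IsLocalRing.residue_eq_zero_iff _ |>.1 this)
      obtain ⟨w, hw⟩ := (hA i).2 _ h0
      have h1 : s • (z - A (i + 1) *ᵥ (B *ᵥ z)) = 0 := by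
        rw [smul_sub, ← Matrix.mulVec_smul, ← Matrix.mulVec_smul, ← hw, Matrix.mulVec_mulVec,
          Matrix.mulVec_mulVec, ← hB, sub_self]
      refine ⟨IsLocalRing.residue S ∘ (B *ᵥ z), ?_⟩
      rw [map_mulVec_comp]
      ext j
      by_contra hj
      -- A nonzero residue would make this entry a unit, and then `h1` would give `s = 0`.
      have hu : IsUnit ((z - A (i + 1) *ᵥ (B *ᵥ z)) j) := by
        rw [← IsLocalRing.residue_ne_zero_iff_isUnit]
        simpa [sub_eq_zero] using fun h => hj (by simpa using h.symm)
      exact hs0 (hu.mul_left_eq_zero.1 (congrFun h1 j))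
  have key : ∀ k i, N ≤ i + k → IsContracted 1 (A (i + 1)) (A i) := by
    intro k
    induction k with
    | zero => exact fun i hi => hN i hi
    | succ k ihk => exact fun i hi => hdesc i (ihk (i + 1) (by omega))
  exact key N _ (by omega)

/-- An acyclic complex of free modules over a Noetherian local ring that is eventually contracted
is contracted in all degrees above the dimension of the ring. -/
theorem IsAcyclic.isContracted_of_ringKrullDim_lt (n : ℕ) :
    ∀ {S : Type u} [CommRing S] [IsLocalRing S] [IsNoetherianRing S] {r : ℕ → ℕ}
      {A : ∀ n, Matrix (Fin (r n)) (Fin (r (n + 1))) S}, ringKrullDim S < (n + 1 : ℕ) →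
      IsAcyclic A → (∃ N, ∀ i, N ≤ i → IsContracted 1 (A (i + 1)) (A i)) →
      IsContracted 1 (A (n + 1)) (A n) := by
  induction n with
  | zero => ?_
  | succ n ih => ?_
  all_goals
    intro S _ _ _ r A hdim hA ⟨N, hN⟩
    -- Depth zero or not: if the maximal ideal consists of zerodivisors, a nonzero element
    -- annihilates it; otherwise it contains a nonzerodivisor `x` to divide by.
    by_cases hdisj : Disjoint (IsLocalRing.maximalIdeal S : Set S) (nonZeroDivisors S)
    · obtain ⟨s, hs, hs0⟩ := SetLike.exists_of_lt
        (Ideal.bot_lt_annihilator_of_disjoint_nonZeroDivisors hdisj)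
      rw [Submodule.mem_annihilator] at hs
      exact hA.isContracted_of_mul_maximalIdeal_eq_zero hs0 hs ⟨N, hN⟩ _
    · obtain ⟨x, hxm, hx⟩ := Set.not_disjoint_iff.1 hdisj
      have hdim' := ringKrullDim_quotient_succ_le_of_nonZeroDivisor hx
      have hnt : Nontrivial (S ⧸ Ideal.span {x}) := Ideal.Quotient.nontrivial_iff.2 fun h =>
        (IsLocalRing.mem_maximalIdeal x).1 hxm (Ideal.span_singleton_eq_top.1 h)
      have hge := ringKrullDim_nonneg_of_nontrivial (R := S ⧸ Ideal.span {x})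
      have hlt := hdim'.trans_lt hdim
      -- For `n = 0` a regular `x` is impossible, since the quotient would have negative dimension.
      -- For `n + 1`, induction applies to the shifted complex modulo `x`; its splitting passes to
      -- the residue field and is then lifted to `S`.
      first
      | exact absurd hlt (not_lt.2 (by simpa using add_le_add_left hge 1))
      | have hlt' : ringKrullDim (S ⧸ Ideal.span {x}) < (n + 1 : ℕ) := by
          by_contra hcon
          exact absurd hlt (not_lt.2 (by simpa using add_le_add_left (not_lt.1 hcon) 1))
        have hloc : IsLocalRing (S ⧸ Ideal.span {x}) :=
          IsLocalRing.of_surjective' (Ideal.Quotient.mk _) Ideal.Quotient.mk_surjective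
        have h1 := ih hlt' (hA.map_mk hx) ⟨N, fun i hi => by
          simpa using (hN (i + 1) (by omega)).map (Ideal.Quotient.mk (Ideal.span {x}))⟩
        refine (hA _).isContracted_of_local ?_
        let f : S ⧸ Ideal.span {x} →+* IsLocalRing.ResidueField S :=
          Ideal.Quotient.lift _ (IsLocalRing.residue S) fun a ha =>
            (IsLocalRing.residue_eq_zero_iff a).2
              ((Ideal.span_singleton_le_iff_mem _).2 hxm ha)
        have h2 := h1.map f
        rw [map_one] at h2
        have h3 : ∀ j, ((A j).map (Ideal.Quotient.mk (Ideal.span {x}))).map f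
            = (A j).map (IsLocalRing.residue S) := fun j => by ext; simp [f]
        rw [h3, h3] at h2
        refine h2.matrixExact ?_
        rw [← Matrix.map_mul, (hA _).1]
        simp

theorem isWeaklyRegular_quotient_of_cons {x : S} {xs : List S}
    (h : RingTheory.Sequence.IsWeaklyRegular S (x :: xs)) :
    x ∈ nonZeroDivisors S ∧ RingTheory.Sequence.IsWeaklyRegular (S ⧸ Ideal.span {x})
      (xs.map (Ideal.Quotient.mk (Ideal.span {x}))) := by
  rw [RingTheory.Sequence.isWeaklyRegular_cons_iff] at h
  refine ⟨?_, ?_⟩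
  · rw [mem_nonZeroDivisors_iff_right]
    intro y hy
    exact h.1 (by simpa [mul_comm] using hy)
  · have e : QuotSMulTop x S ≃ₗ[S] S ⧸ Ideal.span {x} := Submodule.quotEquivOfEq _ _ (by
      rw [← Submodule.ideal_span_singleton_smul]; simp)
    refine (AddEquiv.isWeaklyRegular_congr (e := e.toAddEquiv) ?_).1 h.2
    rw [List.forall₂_map_right_iff, List.forall₂_same]
    intro s _ y
    exact e.map_smul s y

/-- If an acyclic complex is contracted in the degree given by the length of a weakly regular
sequence, then its zeroth homology has no nonzero element killed by that sequence. -/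
theorem IsAcyclic.exists_mulVec_eq_of_isWeaklyRegular (n : ℕ) :
    ∀ {S : Type u} [CommRing S] {r : ℕ → ℕ} {A : ∀ n, Matrix (Fin (r n)) (Fin (r (n + 1))) S}
      {xs : List S}, xs.length = n + 1 → RingTheory.Sequence.IsWeaklyRegular S xs →
      IsAcyclic A → IsContracted 1 (A (n + 1)) (A n) →
      ∀ u : Fin (r 0) → S, (∀ x ∈ xs, ∃ v, A 0 *ᵥ v = x • u) → ∃ v, A 0 *ᵥ v = u := by
  induction n with
  | zero =>
    intro S _ r A xs hlen hreg hA hc u hu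
    obtain ⟨x, rfl⟩ := List.length_eq_one_iff.1 hlen
    obtain ⟨v, hv⟩ := hu x (by simp)
    obtain ⟨B, hB⟩ := hc.smul_left (hA 0).1
    rw [one_smul] at hB
    refine ⟨B *ᵥ u, ?_⟩
    have h : x • (A 0 *ᵥ (B *ᵥ u) - u) = 0 := by
      rw [smul_sub, ← Matrix.mulVec_smul, ← Matrix.mulVec_smul, ← hv, Matrix.mulVec_mulVec,
        Matrix.mulVec_mulVec, ← hB, sub_self]
    exact sub_eq_zero.1 (eq_zero_of_smul_eq_zero (isWeaklyRegular_quotient_of_cons hreg).1 h)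
  | succ n ih =>
    intro S _ r A xs hlen hreg hA hc u hu
    obtain _ | ⟨x, xs⟩ := xs
    · simp at hlen
    obtain ⟨hx, hreg'⟩ := isWeaklyRegular_quotient_of_cons hreg
    obtain ⟨v, hv⟩ := hu x (by simp)
    obtain ⟨w, hw⟩ := ih (by simpa using hlen) hreg' (hA.map_mk hx)
      (by simpa using hc.map (Ideal.Quotient.mk (Ideal.span {x})))
      (Ideal.Quotient.mk _ ∘ v) (by
        intro y hy
        obtain ⟨y, hy', rfl⟩ := List.mem_map.1 hy
        obtain ⟨t, ht⟩ := hu y (by simp [hy'])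
        -- Dimension shifting: from `x • u = A 0 *ᵥ v`, the class of `v` modulo `x` in the cokernel
        -- of `A 1` is killed by the rest of the sequence, because `y • v - x • t` is a boundary.
        have h0 : A 0 *ᵥ (y • v - x • t) = 0 := by
          rw [Matrix.mulVec_sub, Matrix.mulVec_smul, Matrix.mulVec_smul, hv, ht, smul_comm,
            sub_self]
        obtain ⟨z, hz⟩ := (hA 0).2 _ h0
        refine ⟨Ideal.Quotient.mk _ ∘ z, ?_⟩
        rw [map_mulVec_comp, hz]
        ext i
        simp)
    obtain ⟨w, rfl⟩ := exists_mk_comp_eq w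
    obtain ⟨t, ht⟩ := exists_smul_add_of_map_mk_eq hw
    refine ⟨-t, ?_⟩
    have h1 : A 0 *ᵥ (v + x • t) = 0 := by
      rw [← ht, Matrix.mulVec_mulVec, (hA 0).1, Matrix.zero_mulVec]
    rw [Matrix.mulVec_add, hv, Matrix.mulVec_smul, ← smul_add] at h1
    rw [Matrix.mulVec_neg]
    exact (eq_neg_of_add_eq_zero_left (eq_zero_of_smul_eq_zero hx h1)).symm

end Acyclic

/-! ### Minors and ranks -/

section Rank

variable {l m n : Type*} [Fintype l] [Fintype m] [Fintype n] [DecidableEq l] [DecidableEq m]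
  [DecidableEq n]

theorem finrank_range_add_finrank_ker_of_isDomain {R M N : Type*} [CommRing R] [IsDomain R]
    [AddCommGroup M] [Module R M] [Module.Finite R M] [AddCommGroup N] [Module R N]
    (f : M →ₗ[R] N) :
    Module.finrank R (LinearMap.range f) + Module.finrank R (LinearMap.ker f)
      = Module.finrank R M := by
  rw [← f.quotKerEquivRange.finrank_eq, Submodule.finrank_quotient_add_finrank]

theorem exists_linearIndependent_col_submatrix {K : Type*} [Field K] (A : Matrix l m K) {k : ℕ}
    (hk : k ≤ A.rank) : ∃ g : Fin k → m, LinearIndependent K (A.submatrix id g).col := by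
  obtain ⟨f, hf, -, hli⟩ := Submodule.exists_fun_fin_finrank_span_eq K (Set.range A.col)
  choose g hg using hf
  rw [Matrix.rank_eq_finrank_span_cols] at hk
  refine ⟨fun i => g (Fin.castLE hk i), ?_⟩
  have h : (A.submatrix id fun i => g (Fin.castLE hk i)).col = f ∘ Fin.castLE hk :=
    funext fun i => hg _
  rw [h]
  exact hli.comp (Fin.castLE hk) (Fin.castLE_injective hk)

theorem exists_det_submatrix_ne_zero {K : Type*} [Field K] (A : Matrix l m K) {k : ℕ}
    (hk : k ≤ A.rank) : ∃ (f : Fin k → l) (g : Fin k → m), (A.submatrix f g).det ≠ 0 := by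
  obtain ⟨g, hg⟩ := exists_linearIndependent_col_submatrix A hk
  have h1 : k ≤ (A.submatrix id g)ᵀ.rank := by
    rw [LinearIndependent.rank_matrix hg, Fintype.card_fin]
  rw [Matrix.rank_transpose] at h1
  rw [← Matrix.rank_transpose] at h1
  obtain ⟨f, hf⟩ := exists_linearIndependent_col_submatrix _ h1
  refine ⟨f, g, ?_⟩
  rw [← isUnit_iff_ne_zero, ← Matrix.isUnit_iff_isUnit_det,
    ← Matrix.linearIndependent_rows_iff_isUnit]
  exact hf

theorem le_rank_of_det_submatrix_ne_zero {R : Type*} [CommRing R] [IsDomain R] (A : Matrix l m R)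
    {k : ℕ} {f : Fin k → l} {g : Fin k → m} (h : (A.submatrix f g).det ≠ 0) : k ≤ A.rank := by
  have := Matrix.rank_submatrix_le A f g
  rwa [Matrix.rank_of_det_ne_zero h, Fintype.card_fin] at this

/-- A determinantal ideal is not contained in a prime if and only if the matrix has large enough
rank at that prime. -/
theorem not_matrixMinorsIdeal_le_ker_iff {R K : Type*} [CommRing R] [Field K] (φ : R →+* K)
    (A : Matrix l m R) (k : ℕ) :
    ¬ matrixMinorsIdeal A k ≤ RingHom.ker φ ↔ k ≤ (A.map φ).rank := by
  have hdet : ∀ (f : Fin k → l) (g : Fin k → m),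
      φ (A.submatrix f g).det = ((A.map φ).submatrix f g).det := fun f g => by
    rw [RingHom.map_det]
    rfl
  rw [matrixMinorsIdeal, Ideal.span_le, Set.not_subset]
  constructor
  · rintro ⟨_, ⟨f, g, rfl⟩, h⟩
    exact le_rank_of_det_submatrix_ne_zero _ (by rwa [← hdet])
  · intro h
    obtain ⟨f, g, h⟩ := exists_det_submatrix_ne_zero _ h
    exact ⟨_, ⟨f, g, rfl⟩, by simpa [hdet] using h⟩

/-- A minor that survives in `K` was already nonzero in `R`. -/
theorem rank_map_le_rank {R K : Type*} [CommRing R] [IsDomain R] [Field K] (φ : R →+* K)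
    (A : Matrix l m R) : (A.map φ).rank ≤ A.rank := by
  obtain ⟨f, g, h⟩ := exists_det_submatrix_ne_zero (A.map φ) le_rfl
  refine le_rank_of_det_submatrix_ne_zero A (f := f) (g := g) fun h0 => h ?_
  have := φ.map_det (A.submatrix f g)
  rw [h0, map_zero] at this
  exact this.symm

/-- A minor of maximal size `δ` gives a generalized inverse up to the factor `δ`. -/
theorem exists_smul_eq_mul_mul_of_det_submatrix_ne_zero {R : Type*} [CommRing R] [IsDomain R]
    [IsNoetherianRing R] (A : Matrix l m R) {f : Fin A.rank → l} {g : Fin A.rank → m}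
    (h : (A.submatrix f g).det ≠ 0) :
    ∃ B : Matrix m l R, (A.submatrix f g).det • A = A * B * A := by
  set P : Matrix (Fin A.rank) l R := (1 : Matrix l l R).submatrix f id with hP
  set Q : Matrix m (Fin A.rank) R := (1 : Matrix m m R).submatrix id g with hQ
  have hPA : P * A = A.submatrix f id := by
    rw [hP]; ext i j; simp [Matrix.mul_apply, Matrix.one_apply]
  have hPAQ : P * A * Q = A.submatrix f g := by
    rw [hPA, hQ]; ext i j; simp [Matrix.mul_apply, Matrix.one_apply]
  set A' := A.submatrix f g with hA'
  let π := P.mulVecLin.domRestrict (LinearMap.range A.mulVecLin)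
  -- Selecting the rows `f` loses no rank on the image of `A`, so the kernel has rank zero and,
  -- being torsion-free, vanishes. Identities between vectors in the image of `A` may then be
  -- checked after applying `P`.
  have hker : LinearMap.ker π = ⊥ := by
    rw [← Submodule.finrank_eq_zero (R := R)]
    have h1 := finrank_range_add_finrank_ker_of_isDomain π
    have h2 : Module.finrank R (LinearMap.range A.mulVecLin) = A.rank := rfl
    have h3 : A.rank ≤ Module.finrank R (LinearMap.range π) := by
      have h4 : A'.rank = A.rank := by rw [Matrix.rank_of_det_ne_zero h, Fintype.card_fin]
      refine h4.ge.trans (Submodule.finrank_mono ?_)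
      rintro _ ⟨v, rfl⟩
      refine ⟨⟨A *ᵥ (Q *ᵥ v), ⟨_, rfl⟩⟩, ?_⟩
      change P *ᵥ (A *ᵥ (Q *ᵥ v)) = A' *ᵥ v
      rw [Matrix.mulVec_mulVec, Matrix.mulVec_mulVec, hPAQ]
    omega
  refine ⟨Q * A'.adjugate * P, ?_⟩
  have hD : ∀ v, (A'.det • A - A * (Q * A'.adjugate * P) * A) *ᵥ v = 0 := by
    intro v
    have hmem : (A'.det • A - A * (Q * A'.adjugate * P) * A) *ᵥ v
        ∈ LinearMap.range A.mulVecLin := by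
      refine ⟨(A'.det • (1 : Matrix m m R) - (Q * A'.adjugate * P) * A) *ᵥ v, ?_⟩
      rw [Matrix.mulVecLin_apply, Matrix.mulVec_mulVec, Matrix.mul_sub, Matrix.mul_smul,
        Matrix.mul_one, Matrix.mul_assoc A]
    have h0 : (⟨_, hmem⟩ : LinearMap.range A.mulVecLin) ∈ LinearMap.ker π := by
      rw [LinearMap.mem_ker]
      change P *ᵥ ((A'.det • A - A * (Q * A'.adjugate * P) * A) *ᵥ v) = 0
      have : P * (A * (Q * A'.adjugate * P) * A) = (P * A * Q) * A'.adjugate * (P * A) := by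
        simp only [Matrix.mul_assoc]
      rw [Matrix.mulVec_mulVec, Matrix.mul_sub, this, hPAQ, Matrix.mul_adjugate, Matrix.mul_smul,
        Matrix.smul_mul, Matrix.one_mul, sub_self, Matrix.zero_mulVec]
    rw [hker, Submodule.mem_bot] at h0
    exact congrArg Subtype.val h0
  rw [← sub_eq_zero]
  apply Matrix.toLin'.injective
  rw [map_zero]
  exact LinearMap.ext hD

theorem MatrixExact.rank_add_rank {R : Type*} [CommRing R] [IsDomain R] {A₁ : Matrix m n R}
    {A₀ : Matrix l m R} (h : MatrixExact A₁ A₀) : A₁.rank + A₀.rank = Fintype.card m := by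
  have h1 := finrank_range_add_finrank_ker_of_isDomain A₀.mulVecLin
  have h2 : LinearMap.ker A₀.mulVecLin = LinearMap.range A₁.mulVecLin := by
    ext v
    refine ⟨fun hv => h.2 v hv, ?_⟩
    rintro ⟨w, rfl⟩
    rw [LinearMap.mem_ker, Matrix.mulVecLin_apply, Matrix.mulVecLin_apply, Matrix.mulVec_mulVec,
      h.1, Matrix.zero_mulVec]
  rw [h2, Module.finrank_fintype_fun_eq_card] at h1
  rw [add_comm]
  exact h1

theorem rank_fromBlocks_zero {l' m' : Type*} [Fintype l'] [Fintype m'] [DecidableEq l']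
    [DecidableEq m'] {K : Type*} [Field K] (A : Matrix l m K) (B : Matrix l' m' K) :
    (Matrix.fromBlocks A 0 0 B).rank = A.rank + B.rank := by
  have h : Matrix.toLin ((Pi.basisFun K m).prod (Pi.basisFun K m'))
      ((Pi.basisFun K l).prod (Pi.basisFun K l')) (Matrix.fromBlocks A 0 0 B)
      = A.mulVecLin.prodMap B.mulVecLin := by
    rw [← LinearEquiv.eq_symm_apply, Matrix.toLin_symm]
    ext (i | i) (j | j) <;> simp [LinearMap.toMatrix_apply]
  let e : (LinearMap.range A.mulVecLin).prod (LinearMap.range B.mulVecLin) ≃ₗ[K]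
      LinearMap.range A.mulVecLin × LinearMap.range B.mulVecLin :=
    { toFun := fun x => (⟨x.1.1, x.2.1⟩, ⟨x.1.2, x.2.2⟩)
      map_add' := fun _ _ => rfl
      map_smul' := fun _ _ => rfl
      invFun := fun x => ⟨(x.1.1, x.2.1), x.1.2, x.2.2⟩
      left_inv := fun _ => rfl
      right_inv := fun _ => rfl }
  rw [Matrix.rank_eq_finrank_range_toLin _ ((Pi.basisFun K l).prod (Pi.basisFun K l'))
    ((Pi.basisFun K m).prod (Pi.basisFun K m')), h, LinearMap.range_prodMap,
    e.finrank_eq, Module.finrank_prod]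
  rfl

end Rank

/-! ### The determinantal ideals of a complex of matrices over a domain -/

section Ideals

variable {R : Type*} [CommRing R] [IsDomain R] [IsNoetherianRing R] {l m n : Type*} [Fintype l]
  [Fintype m] [Fintype n] [DecidableEq l] [DecidableEq m] [DecidableEq n]
  {A₁ : Matrix m n R} {A₀ : Matrix l m R} {K : Type*} [Field K] (φ : R →+* K)

theorem MatrixExact.exists_isContracted_of_rank_le (h : MatrixExact A₁ A₀)
    (hr : A₀.rank ≤ (A₀.map φ).rank) : ∃ δ, φ δ ≠ 0 ∧ IsContracted δ A₁ A₀ := by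
  rw [← not_matrixMinorsIdeal_le_ker_iff, matrixMinorsIdeal, Ideal.span_le, Set.not_subset] at hr
  obtain ⟨_, ⟨f, g, rfl⟩, hr⟩ := hr
  have h0 : (A₀.submatrix f g).det ≠ 0 := fun h0 => hr (by rw [h0]; exact zero_mem _)
  obtain ⟨B, hB⟩ := exists_smul_eq_mul_mul_of_det_submatrix_ne_zero A₀ h0
  exact ⟨_, hr, h.isContracted hB⟩

/-- The two ranks sum to `card m` over `R`, and neither can grow under `φ`. So the inequality forces
`A₀` to keep its full rank, and a surviving minor provides `δ`. -/
theorem MatrixExact.exists_isContracted_iff (h : MatrixExact A₁ A₀) :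
    (∃ δ, φ δ ≠ 0 ∧ IsContracted δ A₁ A₀) ↔
      Fintype.card m ≤ (A₁.map φ).rank + (A₀.map φ).rank := by
  constructor
  · rintro ⟨δ, hδ, hc⟩
    have h0 : A₀.map φ * A₁.map φ = 0 := by
      rw [← Matrix.map_mul, h.1]
      simp
    exact (((hc.map φ).one_of_isUnit (isUnit_iff_ne_zero.2 hδ)).matrixExact h0).rank_add_rank.ge
  · intro hle
    have h1 := h.rank_add_rank
    have h2 := rank_map_le_rank φ A₁
    exact h.exists_isContracted_of_rank_le φ (by omega)

theorem MatrixExact.exists_isContracted_iff_rank_le (h : MatrixExact A₁ A₀) :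
    (∃ δ, φ δ ≠ 0 ∧ IsContracted δ A₁ A₀) ↔ A₀.rank ≤ (A₀.map φ).rank := by
  refine ⟨fun hc => ?_, h.exists_isContracted_of_rank_le φ⟩
  have h1 := h.rank_add_rank
  have h2 := rank_map_le_rank φ A₁
  have h3 := (h.exists_isContracted_iff φ).1 hc
  omega

end Ideals

/-! ### Comparison of resolutions -/

section Comparison

/-- Recursion for lifting arguments: `P` is the invariant that makes the next choice possible, `Q`
the relation between consecutive choices. -/
theorem exists_seq_of_step {X : ℕ → Type*} (P : ∀ n, X n → Prop)
    (Q : ∀ n, X n → X (n + 1) → Prop) (x : X 0) (hx : P 0 x)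
    (step : ∀ n x, P n x → ∃ y, P (n + 1) y ∧ Q n x y) :
    ∃ s : ∀ n, X n, s 0 = x ∧ ∀ n, Q n (s n) (s (n + 1)) := by
  choose f hf hf' using step
  let s : ∀ n, {x : X n // P n x} := fun n =>
    Nat.rec (motive := fun n => {x : X n // P n x}) ⟨x, hx⟩
      (fun n y => ⟨f n y.1 y.2, hf n y.1 y.2⟩) n
  exact ⟨fun n => (s n).1, rfl, fun n => hf' n (s n).1 (s n).2⟩

variable {R : Type*} [CommRing R]

theorem exists_comp_eq_of_exact {P X Y Z : Type*} [AddCommGroup P] [Module R P]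
    [Module.Projective R P] [AddCommGroup X] [Module R X] [AddCommGroup Y] [Module R Y]
    [AddCommGroup Z] [Module R Z] {g : X →ₗ[R] Y} {h : Y →ₗ[R] Z} (hgh : Function.Exact g h)
    (φ : P →ₗ[R] Y) (hφ : h ∘ₗ φ = 0) : ∃ ψ : P →ₗ[R] X, g ∘ₗ ψ = φ := by
  obtain ⟨ψ, hψ⟩ := Module.projective_lifting_property g.rangeRestrict
    (φ.codRestrict (LinearMap.range g) fun x => (hgh _).1 (LinearMap.congr_fun hφ x))
    g.surjective_rangeRestrict
  refine ⟨ψ, LinearMap.ext fun x => ?_⟩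
  exact congrArg Subtype.val (LinearMap.congr_fun hψ x)

variable {M : Type*} [AddCommGroup M] [Module R M]
  {F : ℕ → Type*} [∀ n, AddCommGroup (F n)] [∀ n, Module R (F n)] [∀ n, Module.Projective R (F n)]
  {G : ℕ → Type*} [∀ n, AddCommGroup (G n)] [∀ n, Module R (G n)] [∀ n, Module.Projective R (G n)]
  {d : ∀ n, F (n + 1) →ₗ[R] F n} {ε : F 0 →ₗ[R] M}
  {e : ∀ n, G (n + 1) →ₗ[R] G n} {η : G 0 →ₗ[R] M}

theorem IsResolution.exists_chainMap (hF : IsResolution d ε) (hG : IsResolution e η) :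
    ∃ f : ∀ n, F n →ₗ[R] G n, η ∘ₗ f 0 = ε ∧ ∀ n, e n ∘ₗ f (n + 1) = f n ∘ₗ d n := by
  obtain ⟨f₀, hf₀⟩ := Module.projective_lifting_property η ε hG.surjective
  have hε : ε ∘ₗ d 0 = 0 := hF.exact_zero.linearMap_comp_eq_zero
  have hd : ∀ n, d n ∘ₗ d (n + 1) = 0 := fun n => (hF.exact_succ n).linearMap_comp_eq_zero
  have h1 : ∀ n (f : F n →ₗ[R] G n), (∃ g, e n ∘ₗ g = f ∘ₗ d n) →
      ∃ g, (∃ g', e (n + 1) ∘ₗ g' = g ∘ₗ d (n + 1)) ∧ e n ∘ₗ g = f ∘ₗ d n := by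
    rintro n f ⟨g, hg⟩
    refine ⟨g, exists_comp_eq_of_exact (hG.exact_succ n) _ ?_, hg⟩
    rw [← LinearMap.comp_assoc, hg, LinearMap.comp_assoc, hd, LinearMap.comp_zero]
  obtain ⟨f, hf, hf'⟩ := exists_seq_of_step
    (P := fun n (f : F n →ₗ[R] G n) => ∃ g, e n ∘ₗ g = f ∘ₗ d n)
    (Q := fun n f g => e n ∘ₗ g = f ∘ₗ d n)
    f₀ (exists_comp_eq_of_exact hG.exact_zero _ (by rw [← LinearMap.comp_assoc, hf₀, hε])) h1
  exact ⟨f, by rw [hf, hf₀], hf'⟩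

theorem IsResolution.exists_homotopy (hF : IsResolution d ε) {φ : ∀ n, F n →ₗ[R] F n}
    (h0 : ε ∘ₗ φ 0 = 0) (hφ : ∀ n, d n ∘ₗ φ (n + 1) = φ n ∘ₗ d n) :
    ∃ h : ∀ n, F n →ₗ[R] F (n + 1), ∀ n, φ (n + 1) = h n ∘ₗ d n + d (n + 1) ∘ₗ h (n + 1) := by
  have hd : ∀ n, d n ∘ₗ d (n + 1) = 0 := fun n => (hF.exact_succ n).linearMap_comp_eq_zero
  obtain ⟨h₀, hh₀⟩ := exists_comp_eq_of_exact hF.exact_zero _ h0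
  obtain ⟨h, -, hh⟩ := exists_seq_of_step
    (P := fun n (h : F n →ₗ[R] F (n + 1)) => d n ∘ₗ (φ (n + 1) - h ∘ₗ d n) = 0)
    (Q := fun n h h' => φ (n + 1) = h ∘ₗ d n + d (n + 1) ∘ₗ h')
    h₀ (by rw [LinearMap.comp_sub, ← LinearMap.comp_assoc, hh₀, hφ, sub_self])
    (fun n h hn => by
      obtain ⟨h', hh'⟩ := exists_comp_eq_of_exact (hF.exact_succ n) _ hn
      refine ⟨h', ?_, by rw [hh']; abel⟩
      rw [LinearMap.comp_sub, ← LinearMap.comp_assoc, hh', hφ, LinearMap.sub_comp,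
        LinearMap.comp_assoc, hd, LinearMap.comp_zero, sub_zero, sub_self])
  exact ⟨h, hh⟩

/-- A resolution of a module with a finite projective resolution is contracted in high degrees. -/
theorem IsResolution.exists_contraction (hF : IsResolution d ε) (hG : IsResolution e η) {N : ℕ}
    (hN : ∀ n, N < n → Subsingleton (G n)) :
    ∃ h : ∀ n, F n →ₗ[R] F (n + 1), ∀ n, N ≤ n →
      LinearMap.id = h n ∘ₗ d n + d (n + 1) ∘ₗ h (n + 1) := by
  obtain ⟨f, hf0, hf⟩ := hF.exists_chainMap hG
  obtain ⟨g, hg0, hg⟩ := hG.exists_chainMap hF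
  -- The round trip through `G` is homotopic to the identity and vanishes where `G` does.
  obtain ⟨h, hh⟩ := hF.exists_homotopy (φ := fun n => LinearMap.id - g n ∘ₗ f n)
    (by rw [LinearMap.comp_sub, ← LinearMap.comp_assoc, hg0, hf0, LinearMap.comp_id, sub_self])
    (fun n => by
      rw [LinearMap.comp_sub, LinearMap.sub_comp, ← LinearMap.comp_assoc, hg,
        LinearMap.comp_assoc, hf, LinearMap.comp_assoc, LinearMap.comp_id, LinearMap.id_comp])
  refine ⟨h, fun n hn => ?_⟩
  rw [← hh]
  have := hN (n + 1) (by omega)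
  have h0 : f (n + 1) = 0 := LinearMap.ext fun x => Subsingleton.elim _ _
  rw [h0, LinearMap.comp_zero, sub_zero]

end Comparison

/-! ### Localization and tensor products -/

section BaseChange

theorem MatrixExact.map_of_isLocalization {R S : Type*} [CommRing R] [IsDomain R] [CommRing S]
    [Algebra R S] (T : Submonoid R) [IsLocalization T S] (hT : T ≤ nonZeroDivisors R)
    {l m n : Type*} [Fintype m] [Fintype n] {A₁ : Matrix m n R} {A₀ : Matrix l m R}
    (h : MatrixExact A₁ A₀) :
    MatrixExact (A₁.map (algebraMap R S)) (A₀.map (algebraMap R S)) := by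
  refine ⟨?_, fun v hv => ?_⟩
  · rw [← Matrix.map_mul, h.1]
    simp
  · obtain ⟨s, hs⟩ := IsLocalization.exist_integer_multiples_of_finite T v
    choose z hz using hs
    have hz' : algebraMap R S ∘ z = algebraMap R S s • v :=
      funext fun i => (hz i).trans (Algebra.smul_def _ _)
    obtain ⟨w, hw⟩ := h.2 z (by
      have h1 : A₀.map (algebraMap R S) *ᵥ (algebraMap R S ∘ z) = 0 := by
        rw [hz', Matrix.mulVec_smul, hv, smul_zero]
      rw [map_mulVec_comp] at h1
      ext i
      apply IsLocalization.injective S hT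
      rw [Pi.zero_apply, map_zero]
      exact congrFun h1 i)
    obtain ⟨t, ht⟩ := (IsLocalization.map_units S s).exists_left_inv
    refine ⟨t • (algebraMap R S ∘ w), ?_⟩
    rw [Matrix.mulVec_smul, map_mulVec_comp, hw, hz', smul_smul, ht, one_smul]

/-- Tensoring preserves the homotopy, and `ψ` inverts `δ` on `A`, so every cycle becomes a boundary.
-/
theorem exact_rTensor_of_contraction {R : Type*} [CommRing R] {X Y Z A : Type*} [AddCommGroup X]
    [Module R X] [AddCommGroup Y] [Module R Y] [AddCommGroup Z] [Module R Z] [AddCommGroup A]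
    [Module R A] {f : X →ₗ[R] Y} {g : Y →ₗ[R] Z} (hfg : g ∘ₗ f = 0) {δ : R} {B : Z →ₗ[R] Y}
    {C : Y →ₗ[R] X} (h : δ • LinearMap.id = B ∘ₗ g + f ∘ₗ C) {ψ : A →ₗ[R] A}
    (hψ : δ • ψ = LinearMap.id) : Function.Exact (f.rTensor A) (g.rTensor A) := by
  intro y
  constructor
  · intro hy
    refine ⟨C.rTensor A (ψ.lTensor Y y), ?_⟩
    have h1 := congrArg (fun k => LinearMap.rTensor A k (ψ.lTensor Y y)) h
    have h2 : g.rTensor A (ψ.lTensor Y y) = 0 := by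
      have : g.rTensor A ∘ₗ ψ.lTensor Y = ψ.lTensor Z ∘ₗ g.rTensor A := by
        rw [LinearMap.rTensor_comp_lTensor, LinearMap.lTensor_comp_rTensor]
      rw [← LinearMap.comp_apply, this, LinearMap.comp_apply, hy, map_zero]
    have h3 : δ • ψ.lTensor Y y = y := by
      rw [← LinearMap.smul_apply, ← LinearMap.lTensor_smul, hψ, LinearMap.lTensor_id,
        LinearMap.id_apply]
    simp only [LinearMap.rTensor_smul, LinearMap.rTensor_add, LinearMap.rTensor_comp,
      LinearMap.rTensor_id, LinearMap.smul_apply, LinearMap.add_apply, LinearMap.comp_apply,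
      LinearMap.id_apply, h2, map_zero, zero_add, h3] at h1
    exact h1.symm
  · rintro ⟨x, rfl⟩
    rw [← LinearMap.comp_apply, ← LinearMap.rTensor_comp, hfg, LinearMap.rTensor_zero,
      LinearMap.zero_apply]

end BaseChange

/-! ### The matrices of a free resolution -/

section Bases

variable {R : Type*} [CommRing R]

theorem matrixMinorsIdeal_succ_le {m n : Type*} (A : Matrix m n R) (k : ℕ) :
    matrixMinorsIdeal A (k + 1) ≤ matrixMinorsIdeal A k := by
  refine Ideal.span_le.2 ?_
  rintro _ ⟨f, g, rfl⟩
  rw [SetLike.mem_coe, Matrix.det_succ_row_zero]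
  exact Ideal.sum_mem _ fun j _ => Ideal.mul_mem_left _ _ (Ideal.subset_span ⟨_, _, rfl⟩)

theorem matrixMinorsIdeal_antitone {m n : Type*} (A : Matrix m n R) :
    Antitone (matrixMinorsIdeal A) :=
  antitone_nat_of_succ_le (matrixMinorsIdeal_succ_le A)

theorem toMatrix_prodMap_eq_fromBlocks {X X' Y Y' : Type*} [AddCommGroup X] [Module R X]
    [AddCommGroup Y] [Module R Y] [AddCommGroup X'] [Module R X'] [AddCommGroup Y'] [Module R Y']
    {ι ι' κ κ' : Type*} [Fintype ι] [Fintype ι'] [Fintype κ] [Fintype κ'] [DecidableEq ι]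
    [DecidableEq ι'] (b : Module.Basis ι R X) (b' : Module.Basis ι' R X')
    (c : Module.Basis κ R Y) (c' : Module.Basis κ' R Y') (f : X →ₗ[R] Y) (g : X' →ₗ[R] Y') :
    LinearMap.toMatrix (b.prod b') (c.prod c') (f.prodMap g)
      = Matrix.fromBlocks (LinearMap.toMatrix b c f) 0 0 (LinearMap.toMatrix b' c' g) := by
  ext (i | i) (j | j) <;> simp [LinearMap.toMatrix_apply]

theorem exists_toMatrix_mulVec_eq_iff {X Y Z : Type*} [AddCommGroup X] [Module R X]
    [AddCommGroup Y] [Module R Y] [AddCommGroup Z] [Module R Z] {ι κ : Type*} [Fintype ι]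
    [Fintype κ] [DecidableEq ι] (b : Module.Basis ι R X) (c : Module.Basis κ R Y) {f : X →ₗ[R] Y}
    {g : Y →ₗ[R] Z} (h : Function.Exact f g) (y : Y) :
    (∃ v, LinearMap.toMatrix b c f *ᵥ v = c.repr y) ↔ g y = 0 := by
  rw [h y]
  constructor
  · rintro ⟨v, hv⟩
    refine ⟨b.equivFun.symm v, c.repr.injective (DFunLike.coe_injective ?_)⟩
    rw [← hv, ← LinearMap.toMatrix_mulVec_repr b c, ← b.equivFun_apply,
      LinearEquiv.apply_symm_apply]
  · rintro ⟨x, rfl⟩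
    exact ⟨b.repr x, LinearMap.toMatrix_mulVec_repr b c f x⟩

theorem matrixExact_toMatrix {X Y Z : Type*} [AddCommGroup X] [Module R X]
    [AddCommGroup Y] [Module R Y] [AddCommGroup Z] [Module R Z] {ι κ l : Type*} [Fintype ι]
    [Fintype κ] [Fintype l] [DecidableEq ι] [DecidableEq κ] (b : Module.Basis ι R X)
    (c : Module.Basis κ R Y) (a : Module.Basis l R Z) {f : X →ₗ[R] Y} {g : Y →ₗ[R] Z}
    (h : Function.Exact f g) :
    MatrixExact (LinearMap.toMatrix b c f) (LinearMap.toMatrix c a g) := by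
  refine ⟨?_, fun v hv => ?_⟩
  · rw [← LinearMap.toMatrix_comp, h.linearMap_comp_eq_zero, map_zero]
  · have h1 : ⇑(c.repr (c.equivFun.symm v)) = v := by
      rw [← c.equivFun_apply, LinearEquiv.apply_symm_apply]
    rw [← h1, exists_toMatrix_mulVec_eq_iff b c h]
    apply a.repr.injective
    apply DFunLike.coe_injective
    rw [← LinearMap.toMatrix_mulVec_repr c a, h1, hv, map_zero]
    rfl

end Bases

/-! ### Jumping and fitting ideals in terms of contractions -/

section Resolution

variable {R : Type*} [CommRing R] {F : ℕ → Type*} [∀ n, AddCommGroup (F n)] [∀ n, Module R (F n)]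
  [∀ n, Module.Free R (F n)] [∀ n, Module.Finite R (F n)]

/-- The matrices of the differentials of a complex of finite free modules in chosen bases. -/
noncomputable def differentialMatrix [Nontrivial R] (d : ∀ n, F (n + 1) →ₗ[R] F n) (n : ℕ) :
    Matrix (Fin (Module.finrank R (F n))) (Fin (Module.finrank R (F (n + 1)))) R :=
  LinearMap.toMatrix (Module.finBasis R (F (n + 1))) (Module.finBasis R (F n)) (d n)

variable [IsDomain R] {d : ∀ n, F (n + 1) →ₗ[R] F n}

theorem rank_differentialMatrix (n : ℕ) :
    (differentialMatrix d n).rank = Module.finrank R (LinearMap.range (d n)) := by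
  rw [differentialMatrix, Matrix.rank_eq_finrank_range_toLin _ (Module.finBasis R (F n))
    (Module.finBasis R (F (n + 1))), Matrix.toLin_toMatrix]

theorem fittingIdeal_succ (n : ℕ) : fittingIdeal d (n + 1)
    = matrixMinorsIdeal (differentialMatrix d n) (differentialMatrix d n).rank := by
  rw [fittingIdeal, rank_differentialMatrix, determinantalIdeal_eq (Module.finBasis R (F (n + 1)))
    (Module.finBasis R (F n))]
  rfl

theorem jumpingIdeal_succ (n : ℕ) : jumpingIdeal d (n + 1)
    = matrixMinorsIdeal (Matrix.fromBlocks (differentialMatrix d (n + 1)) 0 0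
        (differentialMatrix d n)) (Module.finrank R (F (n + 1))) := by
  rw [jumpingIdeal, determinantalIdeal_eq
    ((Module.finBasis R (F (n + 2))).prod (Module.finBasis R (F (n + 1))))
    ((Module.finBasis R (F (n + 1))).prod (Module.finBasis R (F n))),
    toMatrix_prodMap_eq_fromBlocks]
  rfl

theorem jumpingIdeal_zero : jumpingIdeal d 0
    = matrixMinorsIdeal (Matrix.fromBlocks (differentialMatrix d 0) 0 0
        (0 : Matrix (Fin (Module.finrank R PUnit.{1})) (Fin (Module.finrank R (F 0))) R))
        (Module.finrank R (F 0)) := by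
  rw [jumpingIdeal, determinantalIdeal_eq
    ((Module.finBasis R (F 1)).prod (Module.finBasis R (F 0)))
    ((Module.finBasis R (F 0)).prod (Module.finBasis R PUnit.{1})),
    toMatrix_prodMap_eq_fromBlocks, map_zero]
  rfl

theorem jumpingIdeal_zero_le_fittingIdeal_one : jumpingIdeal d 0 ≤ fittingIdeal d 1 := by
  rw [fittingIdeal_succ, jumpingIdeal_zero]
  -- The zero blocks are padding, so the block matrix factors through `differentialMatrix d 0`; its
  -- rank is at most that of `F 0`, and larger minors lie in the ideal of smaller ones.
  have h : Matrix.fromBlocks (differentialMatrix d 0) 0 0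
      (0 : Matrix (Fin (Module.finrank R PUnit.{1})) (Fin (Module.finrank R (F 0))) R)
      = Matrix.fromRows (1 : Matrix (Fin (Module.finrank R (F 0))) (Fin (Module.finrank R (F 0))) R)
          (0 : Matrix (Fin (Module.finrank R PUnit.{1})) (Fin (Module.finrank R (F 0))) R) *
        (differentialMatrix d 0 * Matrix.fromCols
          (1 : Matrix (Fin (Module.finrank R (F 1))) (Fin (Module.finrank R (F 1))) R)
          (0 : Matrix (Fin (Module.finrank R (F 1))) (Fin (Module.finrank R (F 0))) R)) := by
    ext (i | i) (j | j) <;> simp [Matrix.mul_fromCols, Matrix.fromRows_mul]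
  rw [h]
  refine (matrixMinorsIdeal_mul_le_right _ _ _).trans ((matrixMinorsIdeal_mul_le_left _ _ _).trans
    (matrixMinorsIdeal_antitone _ ?_))
  exact (Matrix.rank_le_card_height _).trans_eq (Fintype.card_fin _)

theorem fromBlocks_zero_map {S T l l' m m' : Type*} [CommRing S] [CommRing T] (φ : S →+* T)
    (A : Matrix l m S) (B : Matrix l' m' S) :
    (Matrix.fromBlocks A 0 0 B).map φ = Matrix.fromBlocks (A.map φ) 0 0 (B.map φ) := by
  rw [Matrix.fromBlocks_map]
  simp

section

variable {K : Type*} [Field K] (φ : R →+* K)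

theorem not_jumpingIdeal_zero_le_ker_iff_rank : ¬ jumpingIdeal d 0 ≤ RingHom.ker φ ↔
    Module.finrank R (F 0) ≤ ((differentialMatrix d 0).map φ).rank := by
  rw [jumpingIdeal_zero, not_matrixMinorsIdeal_le_ker_iff, fromBlocks_zero_map,
    rank_fromBlocks_zero]
  simp

variable [IsNoetherianRing R] {M : Type*} [AddCommGroup M] [Module R M] {ε : F 0 →ₗ[R] M}

theorem IsResolution.isAcyclic (hF : IsResolution d ε) : IsAcyclic (differentialMatrix d) :=
  fun n => matrixExact_toMatrix _ _ _ (hF.exact_succ n)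

theorem IsResolution.not_jumpingIdeal_succ_le_ker_iff (hF : IsResolution d ε) (n : ℕ) :
    ¬ jumpingIdeal d (n + 1) ≤ RingHom.ker φ ↔
      ∃ δ, φ δ ≠ 0 ∧ IsContracted δ (differentialMatrix d (n + 1)) (differentialMatrix d n) := by
  rw [(hF.isAcyclic n).exists_isContracted_iff φ, jumpingIdeal_succ,
    not_matrixMinorsIdeal_le_ker_iff, fromBlocks_zero_map, rank_fromBlocks_zero, Fintype.card_fin]

theorem IsResolution.not_fittingIdeal_succ_le_ker_iff (hF : IsResolution d ε) (n : ℕ) :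
    ¬ fittingIdeal d (n + 1) ≤ RingHom.ker φ ↔
      ∃ δ, φ δ ≠ 0 ∧ IsContracted δ (differentialMatrix d (n + 1)) (differentialMatrix d n) := by
  rw [(hF.isAcyclic n).exists_isContracted_iff_rank_le φ, fittingIdeal_succ,
    not_matrixMinorsIdeal_le_ker_iff]

theorem IsResolution.mem_annihilator_iff (hF : IsResolution d ε) (δ : R) :
    δ ∈ Module.annihilator R M ↔
      ∃ C : Matrix (Fin (Module.finrank R (F 1))) (Fin (Module.finrank R (F 0))) R,
        δ • (1 : Matrix (Fin (Module.finrank R (F 0))) (Fin (Module.finrank R (F 0))) R)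
          = differentialMatrix d 0 * C := by
  rw [Module.mem_annihilator]
  constructor
  · intro h
    have h1 : ∀ j, ∃ v, differentialMatrix d 0 *ᵥ v
        = (Module.finBasis R (F 0)).repr (δ • Module.finBasis R (F 0) j) := fun j => by
      rw [differentialMatrix, exists_toMatrix_mulVec_eq_iff _ _ hF.exact_zero, map_smul, h]
    choose v hv using h1
    refine ⟨Matrix.of fun i j => v j i, ?_⟩
    ext i j
    have := congrFun (hv j) i
    rw [map_smul, Module.Basis.repr_self, Finsupp.smul_apply, Finsupp.single_apply] at this
    rw [Matrix.smul_apply, Matrix.one_apply]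
    simp only [eq_comm (a := i)]
    exact this.symm
  · rintro ⟨C, hC⟩ x
    obtain ⟨y, rfl⟩ := hF.surjective x
    rw [← map_smul, ← exists_toMatrix_mulVec_eq_iff (Module.finBasis R (F 1))
      (Module.finBasis R (F 0)) hF.exact_zero]
    refine ⟨C *ᵥ (Module.finBasis R (F 0)).repr y, ?_⟩
    change differentialMatrix d 0 *ᵥ _ = _
    rw [Matrix.mulVec_mulVec, ← hC, Matrix.smul_mulVec, Matrix.one_mulVec, map_smul]
    rfl

theorem IsResolution.isContracted_of_mem_annihilator (hF : IsResolution d ε) {δ : R}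
    (hδ : δ ∈ Module.annihilator R M) :
    IsContracted δ (differentialMatrix d 1) (differentialMatrix d 0) := by
  obtain ⟨C, hC⟩ := (hF.mem_annihilator_iff δ).1 hδ
  refine (hF.isAcyclic 0).isContracted (B := C) ?_
  rw [← hC, Matrix.smul_mul, Matrix.one_mul]

theorem IsResolution.not_jumpingIdeal_zero_le_ker_iff (hF : IsResolution d ε) :
    ¬ jumpingIdeal d 0 ≤ RingHom.ker φ ↔ ¬ Module.annihilator R M ≤ RingHom.ker φ := by
  rw [not_jumpingIdeal_zero_le_ker_iff_rank]
  constructor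
  · intro h
    have hle : (differentialMatrix d 0).rank ≤ Module.finrank R (F 0) :=
      (Matrix.rank_le_card_height _).trans_eq (Fintype.card_fin _)
    obtain ⟨δ, hδ, hc⟩ := (hF.isAcyclic 0).exists_isContracted_of_rank_le φ (hle.trans h)
    obtain ⟨B, hB⟩ := hc.smul_left (hF.isAcyclic 0).1
    refine Set.not_subset.2 ⟨δ, (hF.mem_annihilator_iff δ).2 ⟨B, ?_⟩, hδ⟩
    set A := differentialMatrix d 0 with hA
    have hDA : (δ • 1 - A * B) * A = 0 := by
      rw [Matrix.sub_mul, Matrix.smul_mul, Matrix.one_mul, hB, sub_self]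
    have h1 := finrank_range_add_finrank_ker_of_isDomain (δ • 1 - A * B).mulVecLin
    -- The matrix `δ • 1 - A * B` kills the image of `A`, which has the full rank of `F 0`. Over a
    -- domain it is therefore zero, so `δ` annihilates `M`.
    have h2 : LinearMap.range A.mulVecLin ≤ LinearMap.ker (δ • 1 - A * B).mulVecLin := by
      rintro _ ⟨w, rfl⟩
      rw [LinearMap.mem_ker, Matrix.mulVecLin_apply, Matrix.mulVecLin_apply,
        Matrix.mulVec_mulVec, hDA, Matrix.zero_mulVec]
    have h3 : A.rank ≤ Module.finrank R (LinearMap.ker (δ • 1 - A * B).mulVecLin) :=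
      Submodule.finrank_mono h2
    have h4 := rank_map_le_rank φ A
    rw [Module.finrank_fintype_fun_eq_card, Fintype.card_fin] at h1
    change _ = Module.finrank R (F 0) at h1
    have h5 : Module.finrank R (LinearMap.range (δ • 1 - A * B).mulVecLin) = 0 := by omega
    rw [Submodule.finrank_eq_zero, LinearMap.range_eq_bot] at h5
    rw [← sub_eq_zero]
    apply Matrix.toLin'.injective
    rw [map_zero]
    exact h5
  · intro h
    obtain ⟨δ, hδ, hδ'⟩ := Set.not_subset.1 h
    obtain ⟨C, hC⟩ := (hF.mem_annihilator_iff δ).1 hδ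
    have h1 := congrArg (fun X => (X.map φ).rank) hC
    simp only [Matrix.map_mul] at h1
    have h2 : ((δ • (1 : Matrix (Fin (Module.finrank R (F 0)))
        (Fin (Module.finrank R (F 0))) R)).map φ).rank = Module.finrank R (F 0) := by
      rw [Matrix.rank_of_det_ne_zero, Fintype.card_fin]
      rw [← RingHom.mapMatrix_apply, ← RingHom.map_det, Matrix.det_smul, Matrix.det_one, mul_one,
        map_pow]
      exact pow_ne_zero _ hδ'
    exact (h2.symm.trans h1).le.trans (Matrix.rank_mul_le_left _ _)

end

end Resolution

/-! ### Jumping ideals at a prime -/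

section Primes

theorem radical_le_radical_of_forall_isPrime {R : Type*} [CommRing R] {I J : Ideal R}
    (h : ∀ p : Ideal R, p.IsPrime → J ≤ p → I ≤ p) : I.radical ≤ J.radical := by
  rw [Ideal.radical_eq_sInf J]
  refine le_sInf fun p ⟨hJ, hp⟩ => ?_
  exact (hp.radical_le_iff).2 (h p hp hJ)

theorem exists_eq_mul_algebraMap_of_mem_maximalIdeal {R : Type*} [CommRing R] (p : Ideal R) [p.IsPrime]
    {x : Localization.AtPrime p} (hx : x ∈ IsLocalRing.maximalIdeal (Localization.AtPrime p)) :
    ∃ a ∈ p, ∃ t, x = t * algebraMap R (Localization.AtPrime p) a := by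
  obtain ⟨a, s, rfl⟩ := IsLocalization.exists_mk'_eq p.primeCompl x
  refine ⟨a, (IsLocalization.AtPrime.mk'_mem_maximal_iff (Localization.AtPrime p) p a s).1 hx,
    IsLocalization.mk' _ 1 s, ?_⟩
  rw [mul_comm, ← IsLocalization.mk'_eq_mul_mk'_one]

variable {R : Type*} [CommRing R] [IsDomain R] [IsNoetherianRing R]
  {F : ℕ → Type*} [∀ n, AddCommGroup (F n)] [∀ n, Module R (F n)]
  [∀ n, Module.Free R (F n)] [∀ n, Module.Finite R (F n)]
  {d : ∀ n, F (n + 1) →ₗ[R] F n} {M : Type*} [AddCommGroup M] [Module R M] {ε : F 0 →ₗ[R] M}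
  (p : Ideal R) [p.IsPrime]


theorem IsResolution.not_jumpingIdeal_succ_le_iff (hF : IsResolution d ε) (n : ℕ) :
    ¬ jumpingIdeal d (n + 1) ≤ p ↔
      ∃ δ ∉ p, IsContracted δ (differentialMatrix d (n + 1)) (differentialMatrix d n) := by
  have h := hF.not_jumpingIdeal_succ_le_ker_iff (algebraMap R p.ResidueField) n
  rw [Ideal.ker_algebraMap_residueField] at h
  rw [h]
  simp

theorem IsResolution.not_fittingIdeal_succ_le_iff (hF : IsResolution d ε) (n : ℕ) :
    ¬ fittingIdeal d (n + 1) ≤ p ↔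
      ∃ δ ∉ p, IsContracted δ (differentialMatrix d (n + 1)) (differentialMatrix d n) := by
  have h := hF.not_fittingIdeal_succ_le_ker_iff (algebraMap R p.ResidueField) n
  rw [Ideal.ker_algebraMap_residueField] at h
  rw [h]
  simp

theorem IsResolution.jumpingIdeal_zero_le_iff (hF : IsResolution d ε) :
    jumpingIdeal d 0 ≤ p ↔ Module.annihilator R M ≤ p := by
  have h := hF.not_jumpingIdeal_zero_le_ker_iff (algebraMap R p.ResidueField)
  rw [Ideal.ker_algebraMap_residueField] at h
  exact not_iff_not.1 h

theorem IsResolution.jumpingIdeal_le_of_succ (hF : IsResolution d ε) (n : ℕ)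
    (h : jumpingIdeal d (n + 1) ≤ p) :
    jumpingIdeal d n ≤ p := by
  by_contra hn
  refine (hF.not_jumpingIdeal_succ_le_iff p n).2 ?_ h
  cases n with
  | zero =>
    rw [hF.jumpingIdeal_zero_le_iff p] at hn
    obtain ⟨δ, hδ, hδ'⟩ := Set.not_subset.1 hn
    exact ⟨δ, hδ', hF.isContracted_of_mem_annihilator hδ⟩
  | succ n =>
    obtain ⟨δ, hδ, hc⟩ := (hF.not_jumpingIdeal_succ_le_iff p n).1 hn
    exact ⟨δ, hδ, hc.succ (hF.isAcyclic n).1 (hF.isAcyclic (n + 1))⟩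

theorem IsResolution.exists_isContracted_one (hF : IsResolution d ε)
    (hM : HasFiniteFreeResolution R M) :
    ∃ N, ∀ n, N ≤ n → IsContracted 1 (differentialMatrix d (n + 1)) (differentialMatrix d n) := by
  obtain ⟨r, e, η, hG, N, hN⟩ := hM
  obtain ⟨h, hh⟩ := hF.exists_contraction hG (N := N) fun n hn => by
    rw [hN n hn]
    infer_instance
  refine ⟨N, fun n hn => ⟨LinearMap.toMatrix (Module.finBasis R (F n))
    (Module.finBasis R (F (n + 1))) (h n), LinearMap.toMatrix (Module.finBasis R (F (n + 1)))
    (Module.finBasis R (F (n + 2))) (h (n + 1)), ?_⟩⟩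
  rw [one_smul, ← LinearMap.toMatrix_id (Module.finBasis R (F (n + 1))), hh n hn, map_add,
    LinearMap.toMatrix_comp _ (Module.finBasis R (F n)),
    LinearMap.toMatrix_comp _ (Module.finBasis R (F (n + 2)))]
  rfl

theorem IsResolution.isAcyclic_map_localization (hF : IsResolution d ε) :
    IsAcyclic fun n => (differentialMatrix d n).map (algebraMap R (Localization.AtPrime p)) :=
  fun n => (hF.isAcyclic n).map_of_isLocalization p.primeCompl p.primeCompl_le_nonZeroDivisors

/-- The local ring at `p` has dimension at most `n`, so the localized complex splits here. Passing
to the residue field turns this into a rank equality and back into a `δ ∉ p`. -/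
theorem IsResolution.not_jumpingIdeal_succ_le_of_height_lt (hF : IsResolution d ε)
    (hM : HasFiniteFreeResolution R M)
    (n : ℕ) (hp : p.height < (n + 1 : ℕ)) : ¬ jumpingIdeal d (n + 1) ≤ p := by
  set S := Localization.AtPrime p
  obtain ⟨N, hN⟩ := hF.exists_isContracted_one hM
  have hdim : ringKrullDim S < (n + 1 : ℕ) := by
    rw [IsLocalization.AtPrime.ringKrullDim_eq_height p S]
    exact_mod_cast hp
  have h1 := IsAcyclic.isContracted_of_ringKrullDim_lt n hdim (hF.isAcyclic_map_localization p)
    ⟨N, fun i hi => by simpa using (hN i hi).map (algebraMap R S)⟩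
  have h2 := h1.map (algebraMap S p.ResidueField)
  have h3 : ∀ j, ((differentialMatrix d j).map (algebraMap R S)).map (algebraMap S p.ResidueField)
      = (differentialMatrix d j).map (algebraMap R p.ResidueField) := fun j => by
    rw [Matrix.map_map, IsScalarTower.algebraMap_eq R S p.ResidueField]
    rfl
  rw [map_one, h3, h3] at h2
  have h4 := (hF.isAcyclic n).exists_isContracted_iff (algebraMap R p.ResidueField)
  have h5 := h4.2 (h2.matrixExact (by rw [← Matrix.map_mul, (hF.isAcyclic n).1]; simp)
    |>.rank_add_rank.ge)
  refine (hF.not_jumpingIdeal_succ_le_iff p n).2 ?_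
  simpa using h5

theorem IsResolution.jumpingIdeal_le_of_mem_minimalPrimes (hF : IsResolution d ε)
    [Module.Finite R M]
    (hCM : IsCohenMacaulay R) (hmin : p ∈ (Module.annihilator R M).minimalPrimes) {c : ℕ}
    (hc : p.height = c) : jumpingIdeal d c ≤ p := by
  cases c with
  | zero => exact (hF.jumpingIdeal_zero_le_iff p).2 hmin.1.2
  | succ c =>
    by_contra hn
    obtain ⟨δ, hδ, hcon⟩ := (hF.not_jumpingIdeal_succ_le_iff p c).1 hn
    set S := Localization.AtPrime p
    have h1 : IsContracted 1 ((differentialMatrix d (c + 1)).map (algebraMap R S))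
        ((differentialMatrix d c).map (algebraMap R S)) :=
      (hcon.map (algebraMap R S)).one_of_isUnit
        (IsLocalization.map_units S (⟨δ, hδ⟩ : p.primeCompl))
    obtain ⟨xs, hxs, hreg, hlen⟩ := hCM p
    have hlen' : xs.length = c + 1 := by
      rw [IsLocalization.AtPrime.ringKrullDim_eq_height p S, hc] at hlen
      exact_mod_cast hlen
    -- A minimal prime of the annihilator is associated: `p` is exactly the annihilator of some `u₀`
    -- in `M`.
    have hass := Module.associatedPrimes.minimalPrimes_annihilator_subset_associatedPrimes R M hmin
    obtain ⟨-, u₀, hu₀⟩ := (isAssociatedPrime_iff).1 hass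
    obtain ⟨u, rfl⟩ := hF.surjective u₀
    have hmem : ∀ a : R, a ∈ p ↔ ∃ v, differentialMatrix d 0 *ᵥ v
        = a • ⇑((Module.finBasis R (F 0)).repr u) := fun a => by
      have := exists_toMatrix_mulVec_eq_iff (Module.finBasis R (F 1)) (Module.finBasis R (F 0))
        hF.exact_zero (a • u)
      rw [map_smul, map_smul] at this
      refine Iff.trans ?_ this.symm
      conv_lhs => rw [hu₀]
      simp [Submodule.mem_colon_singleton]
    obtain ⟨v, hv⟩ := IsAcyclic.exists_mulVec_eq_of_isWeaklyRegular c hlen' hreg.toIsWeaklyRegular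
      (hF.isAcyclic_map_localization p) h1
      (algebraMap R S ∘ (Module.finBasis R (F 0)).repr u) (fun x hx => by
        obtain ⟨a, ha, t, rfl⟩ := exists_eq_mul_algebraMap_of_mem_maximalIdeal p (hxs x hx)
        obtain ⟨v, hv⟩ := (hmem a).1 ha
        refine ⟨t • (algebraMap R S ∘ v), ?_⟩
        rw [Matrix.mulVec_smul, map_mulVec_comp, hv]
        ext i
        simp [S, mul_assoc])
    -- The image of `u₀` in the localization is now zero. Clearing denominators gives `s ∉ p`
    -- killing `u₀`, a contradiction.
    obtain ⟨s, hs⟩ := IsLocalization.exist_integer_multiples_of_finite p.primeCompl v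
    choose z hz using hs
    refine s.2 ((hmem s).2 ⟨z, funext fun i => IsLocalization.injective S
      p.primeCompl_le_nonZeroDivisors ?_⟩)
    have hz' : algebraMap R S ∘ z = algebraMap R S s • v :=
      funext fun i => (hz i).trans (Algebra.smul_def _ _)
    have h2 := congrFun (map_mulVec_comp (algebraMap R S) (differentialMatrix d 0) z) i
    rw [hz', Matrix.mulVec_smul, hv] at h2
    refine h2.symm.trans ?_
    simp

theorem exists_contraction_of_isContracted {δ : R} {n : ℕ}
    (h : IsContracted δ (differentialMatrix d (n + 1)) (differentialMatrix d n)) :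
    ∃ (B : F n →ₗ[R] F (n + 1)) (C : F (n + 1) →ₗ[R] F (n + 2)),
      δ • LinearMap.id = B ∘ₗ d n + d (n + 1) ∘ₗ C := by
  obtain ⟨B, C, h⟩ := h
  refine ⟨Matrix.toLin (Module.finBasis R (F n)) (Module.finBasis R (F (n + 1))) B,
    Matrix.toLin (Module.finBasis R (F (n + 1))) (Module.finBasis R (F (n + 2))) C, ?_⟩
  have h1 := congrArg (Matrix.toLin (Module.finBasis R (F (n + 1)))
    (Module.finBasis R (F (n + 1)))) h
  rw [map_smul, Matrix.toLin_one, map_add, Matrix.toLin_mul _ (Module.finBasis R (F n)),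
    Matrix.toLin_mul _ (Module.finBasis R (F (n + 2)))] at h1
  simpa [differentialMatrix] using h1

theorem IsResolution.cohomologyVanishes (hF : IsResolution d ε) {δ : R}
    (h : IsContracted δ (differentialMatrix d 1) (differentialMatrix d 0)) {A : Type*}
    [AddCommGroup A] [Module R A] {ψ : A →ₗ[R] A} (hψ : δ • ψ = LinearMap.id) :
    CohomologyVanishes d A := by
  have h1 : ∀ n, IsContracted δ (differentialMatrix d (n + 1)) (differentialMatrix d n) := by
    intro n
    induction n with
    | zero => exact h
    | succ n ih => exact ih.succ (hF.isAcyclic n).1 (hF.isAcyclic (n + 1))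
  intro n
  obtain ⟨B, C, hBC⟩ := exists_contraction_of_isContracted (h1 n)
  exact exact_rTensor_of_contraction (hF.exact_succ n).linearMap_comp_eq_zero hBC hψ

/-- Substituting `rank F (n + 1) = rank d (n + 1) + rank d n` makes the sum telescope. -/
theorem IsResolution.sum_finrank_eq (hF : IsResolution d ε) (N : ℕ) :
    ∑ n ∈ Finset.range (N + 1), (-1 : ℤ) ^ n * (Module.finrank R (F n) : ℤ)
      = Module.finrank R (F 0) - (differentialMatrix d 0).rank
        + (-1) ^ N * (differentialMatrix d N).rank := by
  induction N with
  | zero => simp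
  | succ N ih =>
    have h : (differentialMatrix d (N + 1)).rank + (differentialMatrix d N).rank
        = Module.finrank R (F (N + 1)) :=
      (hF.isAcyclic N).rank_add_rank.trans (Fintype.card_fin _)
    have h' := congrArg (Nat.cast (R := ℤ)) h
    rw [Nat.cast_add] at h'
    rw [Finset.sum_range_succ, ih, ← h']
    ring

end Primes

/-! ### The jump loci -/

section Loci

theorem exists_smul_eq_id_of_isUnit {R A : Type*} [CommRing R] [CommRing A] [Algebra R A] {δ : R}
    (hδ : IsUnit (algebraMap R A δ)) : ∃ ψ : A →ₗ[R] A, δ • ψ = LinearMap.id := by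
  obtain ⟨a, ha⟩ := hδ.exists_right_inv
  refine ⟨LinearMap.mulLeft R a, LinearMap.ext fun x => ?_⟩
  rw [LinearMap.smul_apply, LinearMap.mulLeft_apply, Algebra.smul_def, ← mul_assoc, ha, one_mul,
    LinearMap.id_apply]

theorem eq_of_forall_isMaximal_le_iff {R : Type*} [CommRing R] [IsJacobsonRing R] {I J : Ideal R}
    (hI : I.IsRadical) (hJ : J.IsRadical) (h : ∀ m : Ideal R, m.IsMaximal → (I ≤ m ↔ J ≤ m)) :
    I = J := by
  rw [← IsJacobsonRing.out ‹_› hI, ← IsJacobsonRing.out ‹_› hJ, Ideal.jacobson, Ideal.jacobson]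
  congr 1
  ext m
  exact and_congr_left (h m)

variable {R : Type*} [CommRing R] [IsDomain R] [IsNoetherianRing R]
  {F : ℕ → Type*} [∀ n, AddCommGroup (F n)] [∀ n, Module R (F n)]
  [∀ n, Module.Free R (F n)] [∀ n, Module.Finite R (F n)]
  {d : ∀ n, F (n + 1) →ₗ[R] F n} {M : Type*} [AddCommGroup M] [Module R M] {ε : F 0 →ₗ[R] M}

theorem IsResolution.radical_jumpingIdeal_zero (hF : IsResolution d ε) :
    (jumpingIdeal d 0).radical = (Module.annihilator R M).radical :=
  le_antisymm
    (radical_le_radical_of_forall_isPrime fun p _ => (hF.jumpingIdeal_zero_le_iff p).2)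
    (radical_le_radical_of_forall_isPrime fun p _ => (hF.jumpingIdeal_zero_le_iff p).1)

theorem IsResolution.radical_fittingIdeal_succ (hF : IsResolution d ε) (n : ℕ) :
    (fittingIdeal d (n + 1)).radical = (jumpingIdeal d (n + 1)).radical := by
  have h : ∀ (p : Ideal R) [p.IsPrime], jumpingIdeal d (n + 1) ≤ p ↔ fittingIdeal d (n + 1) ≤ p :=
    fun p _ => not_iff_not.1
      ((hF.not_jumpingIdeal_succ_le_iff p n).trans (hF.not_fittingIdeal_succ_le_iff p n).symm)
  exact le_antisymm (radical_le_radical_of_forall_isPrime fun p _ => (h p).1)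
    (radical_le_radical_of_forall_isPrime fun p _ => (h p).2)

theorem IsResolution.radical_jumpingIdeal_monotone (hF : IsResolution d ε) :
    Monotone fun i => (jumpingIdeal d i).radical :=
  monotone_nat_of_le_succ fun i => radical_le_radical_of_forall_isPrime fun p _ =>
    hF.jumpingIdeal_le_of_succ p i

theorem IsResolution.le_codimJumpLocus (hF : IsResolution d ε)
    (hM : HasFiniteFreeResolution R M) (i : ℕ) : (i : ℕ∞) ≤ codimJumpLocus d i := by
  rw [codimJumpLocus, Ideal.height_eq_inf_minimalPrimes]
  refine le_iInf₂ fun p hp => ?_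
  have := hp.1.1
  cases i with
  | zero => simp
  | succ n =>
    by_contra hlt
    exact hF.not_jumpingIdeal_succ_le_of_height_lt p hM n (not_le.1 hlt)
      (Ideal.le_radical.trans hp.1.2)

theorem IsResolution.jumpingIdeal_le_of_mem_minimalPrimes_radical [Module.Finite R M]
    (hF : IsResolution d ε) (hCM : IsCohenMacaulay R) {p : Ideal R}
    (hp : p ∈ (jumpingIdeal d 0).radical.minimalPrimes) {c : ℕ} (hc : p.height = c) :
    (jumpingIdeal d c).radical ≤ p := by
  have := hp.1.1
  rw [hF.radical_jumpingIdeal_zero, Ideal.radical_minimalPrimes] at hp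
  exact (Ideal.IsPrime.radical_le_iff this).2 (hF.jumpingIdeal_le_of_mem_minimalPrimes p hCM hp hc)

theorem codimJumpLocus_le_height {i : ℕ} {p : Ideal R} (h : (jumpingIdeal d i).radical ≤ p) :
    codimJumpLocus d i ≤ p.height :=
  Ideal.height_mono h

theorem exists_height_eq_natCast (p : Ideal R) [p.IsPrime] : ∃ k : ℕ, p.height = k := by
  obtain ⟨k, hk⟩ := ENat.ne_top_iff_exists.1 (Ideal.height_ne_top (I := p) Ideal.IsPrime.ne_top')
  exact ⟨k, hk.symm⟩

/-- A prime over `J^0` contains a minimal one `q`, of some height `k ≥ i`; then `q` contains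
`J^{-k}`, hence `J^{-i}` by propagation. -/
theorem IsResolution.radical_jumpingIdeal_eq_of_le_codim [Module.Finite R M]
    (hF : IsResolution d ε) (hCM : IsCohenMacaulay R) {i : ℕ} (hi : (i : ℕ∞) ≤ codimJumpLocus d 0) :
    (jumpingIdeal d i).radical = (jumpingIdeal d 0).radical := by
  refine le_antisymm (radical_le_radical_of_forall_isPrime fun p hp h0 => ?_)
    (hF.radical_jumpingIdeal_monotone (Nat.zero_le i))
  obtain ⟨q, hq, hqp⟩ := Ideal.exists_minimalPrimes_le (hp.radical_le_iff.2 h0)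
  have := hq.1.1
  obtain ⟨k, hk⟩ := exists_height_eq_natCast q
  have hik : i ≤ k := by
    have := hi.trans (codimJumpLocus_le_height hq.1.2)
    rw [hk] at this
    exact_mod_cast this
  exact Ideal.le_radical.trans ((hF.radical_jumpingIdeal_monotone hik).trans
    ((hF.jumpingIdeal_le_of_mem_minimalPrimes_radical hCM hq hk).trans hqp))

/-- A component of height `k > c` would contain `J^{-k}` and bound its codimension by `k`. -/
theorem IsResolution.height_eq_of_lt_codim [Module.Finite R M] (hF : IsResolution d ε)
    (hCM : IsCohenMacaulay R) {c : ℕ} (hc : codimJumpLocus d 0 = c)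
    (h : ∀ k : ℕ, c < k → (k : ℕ∞) < codimJumpLocus d k) {p : Ideal R}
    (hp : p ∈ (jumpingIdeal d 0).radical.minimalPrimes) : p.height = c := by
  have := hp.1.1
  obtain ⟨k, hk⟩ := exists_height_eq_natCast p
  have h1 := codimJumpLocus_le_height hp.1.2
  rw [hc, hk, Nat.cast_le] at h1
  obtain rfl | hlt := h1.eq_or_lt
  · exact hk
  · have h2 := codimJumpLocus_le_height (hF.jumpingIdeal_le_of_mem_minimalPrimes_radical hCM hp hk)
    rw [hk] at h2
    exact absurd h2 (not_le.2 (h k hlt))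

/-- The codimension bound at the zero ideal, which has height `0 < 1`. -/
theorem IsResolution.exists_ne_zero_isContracted (hF : IsResolution d ε)
    (hM : HasFiniteFreeResolution R M) :
    ∃ δ ≠ 0, IsContracted δ (differentialMatrix d 1) (differentialMatrix d 0) := by
  obtain ⟨δ, hδ, h⟩ := (hF.not_jumpingIdeal_succ_le_iff ⊥ 0).1
    (hF.not_jumpingIdeal_succ_le_of_height_lt ⊥ hM 0 (by simp))
  exact ⟨δ, by simpa using hδ, h⟩

theorem IsResolution.sum_finrank_nonneg (hF : IsResolution d ε) {N : ℕ}
    (hN : Module.finrank R (F (N + 1)) = 0) :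
    0 ≤ ∑ n ∈ Finset.range (N + 1), (-1 : ℤ) ^ n * (Module.finrank R (F n) : ℤ) := by
  rw [hF.sum_finrank_eq]
  have h0 : (differentialMatrix d N).rank = 0 := by
    have h := (Matrix.rank_le_card_width (differentialMatrix d N)).trans_eq (Fintype.card_fin _)
    exact Nat.le_zero.1 (h.trans_eq hN)
  have h1 : (differentialMatrix d 0).rank ≤ Module.finrank R (F 0) :=
    (Matrix.rank_le_card_height _).trans_eq (Fintype.card_fin _)
  rw [h0]
  simpa using h1

end Loci

end JumpLoci

/-! ### The main theorem -/

theorem mainTheorem6 {R : Type*} [CommRing R] [IsDomain R] [IsNoetherianRing R]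
    (hCM : JumpLoci.IsCohenMacaulay R)
    {M : Type*} [AddCommGroup M] [Module R M] [Module.Finite R M]
    (hM : JumpLoci.HasFiniteFreeResolution R M)
    {F : ℕ → Type*} [∀ n, AddCommGroup (F n)] [∀ n, Module R (F n)]
    [∀ n, Module.Free R (F n)] [∀ n, Module.Finite R (F n)]
    (d : ∀ n, F (n + 1) →ₗ[R] F n) (ε : F 0 →ₗ[R] M) (hF : JumpLoci.IsResolution d ε) :
    -- comparison of the ideals
    JumpLoci.jumpingIdeal d 0 ≤ JumpLoci.fittingIdeal d 1 ∧
    (JumpLoci.jumpingIdeal d 0).radical = (Module.annihilator R M).radical ∧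
    (∀ i, 1 ≤ i →
      (JumpLoci.fittingIdeal d i).radical = (JumpLoci.jumpingIdeal d i).radical) ∧
    -- (i) propagation
    (∀ i, (JumpLoci.jumpingIdeal d i).radical ≤ (JumpLoci.jumpingIdeal d (i + 1)).radical ∧
      JumpLoci.jumpLocus d (i + 1) ⊆ JumpLoci.jumpLocus d i) ∧
    -- (ii) codimension lower bound
    (∀ i : ℕ, (i : ℕ∞) ≤ JumpLoci.codimJumpLocus d i) ∧
    -- (iii) irreducible components
    (∀ (c : ℕ) (p : Ideal R), p ∈ (JumpLoci.jumpingIdeal d 0).radical.minimalPrimes →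
      p.height = c →
        {χ : MaximalSpectrum R | p ≤ χ.asIdeal} ⊆ JumpLoci.jumpLocus d c ∧
        p ∈ (JumpLoci.jumpingIdeal d c).radical.minimalPrimes) ∧
    -- (iv) equality of the loci up to the codimension, and purity
    (∀ c : ℕ, JumpLoci.codimJumpLocus d 0 = c →
      (∀ i, i ≤ c →
        (JumpLoci.jumpingIdeal d i).radical = (JumpLoci.jumpingIdeal d 0).radical ∧
        JumpLoci.jumpLocus d i = JumpLoci.jumpLocus d 0) ∧
      (JumpLoci.jumpingIdeal d c).radical ≠ (JumpLoci.jumpingIdeal d (c + 1)).radical ∧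
      (IsJacobsonRing R → JumpLoci.jumpLocus d c ≠ JumpLoci.jumpLocus d (c + 1)) ∧
      ((∀ k : ℕ, c < k → (k : ℕ∞) < JumpLoci.codimJumpLocus d k) →
        (∀ p ∈ (JumpLoci.jumpingIdeal d 0).radical.minimalPrimes, p.height = c) ∧
        ((∀ p : Ideal R, p.IsPrime →
            (p.height : WithBot ℕ∞) + ringKrullDim (R ⧸ p) = ringKrullDim R) →
          ∀ p ∈ (JumpLoci.jumpingIdeal d 0).radical.minimalPrimes,
          ∀ q ∈ (JumpLoci.jumpingIdeal d 0).radical.minimalPrimes,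
            ringKrullDim (R ⧸ p) = ringKrullDim (R ⧸ q)))) ∧
    -- (v) generic vanishing
    (∃ U : Set (PrimeSpectrum R), IsOpen U ∧ U.Nonempty ∧
      (∀ p ∈ U, JumpLoci.CohomologyVanishes d p.asIdeal.ResidueField) ∧
      (∀ χ : MaximalSpectrum R, χ.toPrimeSpectrum ∈ U →
        JumpLoci.CohomologyVanishes d (R ⧸ χ.asIdeal))) ∧
    (IsJacobsonRing R → ∃ U : Set (MaximalSpectrum R), IsOpen U ∧ U.Nonempty ∧
      ∀ χ ∈ U, JumpLoci.CohomologyVanishes d (R ⧸ χ.asIdeal)) ∧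
    -- (vi) signed Euler characteristic
    (∀ N : ℕ, (∀ n, N < n → Module.finrank R (F n) = 0) →
      0 ≤ ∑ n ∈ Finset.range (N + 1), (-1 : ℤ) ^ n * (Module.finrank R (F n) : ℤ)) := by
  have hcoh : ∀ (δ : R), JumpLoci.IsContracted δ (JumpLoci.differentialMatrix d 1)
      (JumpLoci.differentialMatrix d 0) → ∀ χ : MaximalSpectrum R, δ ∉ χ.asIdeal →
      JumpLoci.CohomologyVanishes d (R ⧸ χ.asIdeal) := by
    intro δ hc χ hχ
    have hu : IsUnit (algebraMap R (R ⧸ χ.asIdeal) δ) := by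
      let := Ideal.Quotient.field χ.asIdeal
      exact isUnit_iff_ne_zero.2 fun h => hχ (Ideal.Quotient.eq_zero_iff_mem.1 h)
    obtain ⟨ψ, hψ⟩ := JumpLoci.exists_smul_eq_id_of_isUnit hu
    exact hF.cohomologyVanishes hc hψ
  obtain ⟨δ, hδ, hδc⟩ := hF.exists_ne_zero_isContracted hM
  refine ⟨JumpLoci.jumpingIdeal_zero_le_fittingIdeal_one, hF.radical_jumpingIdeal_zero,
    fun i hi => ?_, fun i => ?_, hF.le_codimJumpLocus hM, fun c p hp hc => ?_, fun c hc => ?_,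
    ?_, fun hJ => ?_, fun N hN => hF.sum_finrank_nonneg (hN _ N.lt_succ_self)⟩
  · obtain ⟨n, rfl⟩ := Nat.exists_eq_add_of_le' hi
    exact hF.radical_fittingIdeal_succ n
  · have h := hF.radical_jumpingIdeal_monotone i.le_succ
    exact ⟨h, fun χ hχ => h.trans hχ⟩
  · have h := hF.jumpingIdeal_le_of_mem_minimalPrimes_radical hCM hp hc
    refine ⟨fun χ hχ => h.trans hχ, ⟨hp.1.1, h⟩, fun q hq hqp => ?_⟩
    exact hp.2 ⟨hq.1, (hF.radical_jumpingIdeal_monotone (Nat.zero_le c)).trans hq.2⟩ hqp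
  · have heq : ∀ i, i ≤ c → (JumpLoci.jumpingIdeal d i).radical
        = (JumpLoci.jumpingIdeal d 0).radical := fun i hi =>
      hF.radical_jumpingIdeal_eq_of_le_codim hCM (by rw [hc]; exact_mod_cast hi)
    -- Equality would give `J^{-c-1}` codimension `c`, against the lower bound `c + 1`.
    have hne : (JumpLoci.jumpingIdeal d c).radical ≠ (JumpLoci.jumpingIdeal d (c + 1)).radical := by
      intro h
      have h1 := hF.le_codimJumpLocus hM (c + 1)
      rw [JumpLoci.codimJumpLocus, ← h, heq c le_rfl] at h1
      have h2 := h1.trans_eq hc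
      rw [Nat.cast_le] at h2
      omega
    refine ⟨fun i hi => ⟨heq i hi, ?_⟩, hne, fun hJ h => hne ?_, fun h => ?_⟩
    · rw [JumpLoci.jumpLocus, JumpLoci.jumpLocus, heq i hi]
    · exact JumpLoci.eq_of_forall_isMaximal_le_iff (Ideal.radical_isRadical _)
        (Ideal.radical_isRadical _) fun m hm => Set.ext_iff.1 h ⟨m, hm⟩
    · have hpure := fun p hp => hF.height_eq_of_lt_codim hCM hc h (p := p) hp
      refine ⟨hpure, fun hdim p hp q hq => ?_⟩
      have h1 := (hdim p hp.1.1).trans (hdim q hq.1.1).symm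
      rw [hpure p hp, hpure q hq] at h1
      exact ENat.WithBot.natCast_add_cancel.1 h1
  · refine ⟨PrimeSpectrum.basicOpen δ, (PrimeSpectrum.basicOpen δ).isOpen, ⟨⊥, ?_⟩,
      fun p hp => ?_, fun χ hχ => hcoh δ hδc χ hχ⟩
    · simpa [PrimeSpectrum.mem_basicOpen] using hδ
    · have hu : IsUnit (algebraMap R p.asIdeal.ResidueField δ) :=
        isUnit_iff_ne_zero.2 fun h => hp (Ideal.algebraMap_residueField_eq_zero.1 h)
      obtain ⟨ψ, hψ⟩ := JumpLoci.exists_smul_eq_id_of_isUnit hu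
      exact hF.cohomologyVanishes hδc hψ
  · refine ⟨MaximalSpectrum.toPrimeSpectrum ⁻¹' PrimeSpectrum.basicOpen δ,
      (PrimeSpectrum.basicOpen δ).isOpen.preimage MaximalSpectrum.toPrimeSpectrum_continuous, ?_,
      fun χ hχ => hcoh δ hδc χ hχ⟩
    -- If the open set were empty, `δ` would lie in every maximal ideal; in a Jacobson domain their
    -- intersection is zero.
    by_contra hemp
    refine hδ ?_
    have h1 : δ ∈ (⊥ : Ideal R).jacobson := by
      rw [Ideal.jacobson, Ideal.mem_sInf]
      intro m hm
      by_contra hδm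
      exact hemp ⟨⟨m, hm.2⟩, hδm⟩
    rwa [IsJacobsonRing.out hJ (Ideal.isPrime_bot.isRadical), Ideal.mem_bot] at h1
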